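/- **Setting.** Consider a finite state space $\mathcal S$, a finite action set $\mathcal A$ with $A=|\mathcal A|$, nonempty sets $\mathcal A_s\subseteq\mathcal A$ of actions allowed in state $s$, and transition probabilities $P(s'\mid s,a)$, such that every deterministic stationary policy $\beta$ (a map $\mathcal S\to\mathcal A$ with $\beta(s)\in\mathcal A_s$) induces an irreducible and aperiodic Markov chain; $\pi_\beta$ denotes its stationary distribution. (For an energy harvesting transmitter the state is the battery level, the action is the transmit power, and $s_{t+1}=\min\{s_t-a_t+p_t,Q_{\max}\}$ with harvested powers $p_t$.) There are $M\ge 1$ channels. In each slot $t=1,2,\dots$ the agent sees the state $s_t$, chooses $a_t\in\mathcal A_{s_t}$ and a channel $j_t$, and receives the rate $r_t=f(a_t,X_{t,j_t})$, where $f\ge 0$ is a known function such that every $f(a,\cdot)$ is measurable and bounded on the set $\mathcal X$ of possible gains. The gains $X_{t,j}$ of channel $j$ are i.i.d. over $t$ with unknown law, and the gains of slot $t$ are independent of everything known when the decision of slot $t$ is made; given that information, the next state has law $P(\cdot\mid s_t,a_t)$. Put $\mu_j(a)=\mathbb E f(a,X_j)$, $\phi^*(a)\in\arg\max_j\mu_j(a)$,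 $\mu^*(a)=\max_j\mu_j(a)$, $\rho(\beta)=\sum_s\pi_\beta(s)\,\mu^*(\beta(s))$, $\beta^*\in\arg\max_\beta\rho(\beta)$, $\rho^*=\rho(\beta^*)$, and let $P_*$ be the transition matrix of $\beta^*$. The $T$-slot regret is $\mathfrak R(T)=T\rho^*-\mathbb E\big[\sum_{t=1}^T r_t\big]$. Define $$\gamma=\max_{s,s'}\|P_*(s',\cdot)-P_*(s,\cdot)\|_{\mathrm{TV}},\quad \mu_{\max}=\max_a\mu^*(a),\quad \Delta_{\max}=\rho^*-\min_{a,j}\mu_j(a),$$ $$\Delta_3=\min\{\mu^*(a)-\mu_j(a): a\in\mathcal A,\ j\notin\arg\max_i\mu_i(a)\},\quad \Delta_4=\rho^*-\max_{\beta\ne\beta^*}\rho(\beta),\quad B_0=\max_a\Big(\sup_{x\in\mathcal X} f(a,x)-\inf_{x\in\mathcal X} f(a,x)\Big),$$ where $\Delta_3$ and $\Delta_4$ are $+\infty$ if the minimum, respectively the maximum, is over the empty set. Assume $B_0>0$ and $\gamma<1$ (the latter is automatic for the energy harvesting transmitter if every harvested power $0,\dots,Q_{\max}$ has positive probability). **Algorithm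 MC-LPSM.** Let $\mathcal R\subseteq\{1,2,\dots\}$ be the set of exploration slots and $\mathcal R(t)=\mathcal R\cap[1,t]$. The algorithm keeps estimates $\theta_j(a)$ and counters $m_j$, initially $0$. In a slot $n\in\mathcal R$ it uses channel $j=((n-1)\bmod M)+1$ with an arbitrary valid action, and then sets $\theta_j(a)\leftarrow\frac{m_j\theta_j(a)+f(a,X_{n,j})}{m_j+1}$ for all $a\in\mathcal A$ and $m_j\leftarrow m_j+1$. In a slot $n\notin\mathcal R$ with $n-1\in\mathcal R$ it picks $\phi(a)\in\arg\max_j\theta_j(a)$ for all $a$, a solution $\pi$ of the linear program $$\max\sum_{s}\sum_{a\in\mathcal A_s}\pi(s,a)\,\theta_{\phi(a)}(a)\quad\text{s.t. } \pi\ge 0,\ \sum_{s}\sum_{a\in\mathcal A_s}\pi(s,a)=1,\ \sum_{a\in\mathcal A_{s'}}\pi(s',a)=\sum_s\sum_{a\in\mathcal A_s}\pi(s,a)P(s'\mid s,a)\ \ \forall s',$$ and $\beta(s)\in\arg\max_{a\in\mathcal A_s}\pi(s,a)$, with ties broken arbitrarily; in the other slots $n\notin\mathcal R$, $n\ge2$,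 it keeps $\beta$ and $\phi$. In every slot $n\notin\mathcal R$ it plays $a_n=\beta(s_n)$ on channel $\phi(a_n)$. (If $1\notin\mathcal R$, then $\beta,\phi$ are arbitrary in slot $1$.) **Theorem.** Let $0<d\le\min\{\Delta_3,\Delta_4\}$ and $w>\frac{2B_0^2}{d^2}$, and let $\mathcal R$ be such that for every $t>1$: $t\in\mathcal R$ if and only if $|\mathcal R(t-1)|<M\lceil w\ln t\rceil$ (slot $1$ may or may not belong to $\mathcal R$). Then, for every initial distribution of the state and every $T\ge1$, MC-LPSM satisfies $$\mathfrak R(T)\le\Big(M\lceil w\ln T\rceil+2AM\,c_{(wd^2/(2B_0^2))}\Big)\Big(\Delta_{\max}+\frac{\mu_{\max}}{1-\gamma}\Big),\qquad c_{(x)}=\sum_{t=1}^\infty t^{-x},$$ where the series $c_{(wd^2/(2B_0^2))}$ converges. -/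

import Mathlib

open MeasureTheory ProbabilityTheory
open scoped Matrix

namespace MCLPSM

noncomputable section

/-! ### Finite Markov decision processes -/

/-- The controlled dynamics of a finite Markov decision process: the set `act s` of actions allowed
in state `s` and the probabilities `trans s a s'` of moving from `s` to `s'` under action `a`.
Rewards are handled separately, since they depend on the action and the channel only. -/
structure MDP (S A : Type*) [Fintype S] where
  act : S → Finset A
  act_nonempty : ∀ s, (act s).Nonempty
  trans : S → A → S → ℝ
  trans_nonneg : ∀ s, ∀ a ∈ act s, ∀ s', 0 ≤ trans s a s'
  trans_sum : ∀ s, ∀ a ∈ act s, ∑ s', trans s a s' = 1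

/-- Deterministic stationary policies (state-action mappings). -/
abbrev MDP.Policy {S A : Type*} [Fintype S] (𝓜 : MDP S A) : Type _ :=
  (s : S) → {a : A // a ∈ 𝓜.act s}

instance {S A : Type*} [Fintype S] (𝓜 : MDP S A) : Nonempty 𝓜.Policy :=
  ⟨fun s => ⟨(𝓜.act_nonempty s).choose, (𝓜.act_nonempty s).choose_spec⟩⟩

/-- Transition matrix of the Markov chain induced by a policy. -/
def MDP.chain {S A : Type*} [Fintype S] (𝓜 : MDP S A) (β : 𝓜.Policy) : Matrix S S ℝ :=
  Matrix.of fun s s' => 𝓜.trans s (β s) s'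

/-- A nonnegative matrix is aperiodic if, for every state, the set of its possible return times
has greatest common divisor `1`. -/
def IsAperiodic {S : Type*} [Fintype S] [DecidableEq S] (P : Matrix S S ℝ) : Prop :=
  ∀ s, ∀ k : ℕ, (∀ n, 1 ≤ n → 0 < (P ^ n) s s → k ∣ n) → k = 1

/-- An MDP is ergodic if every deterministic stationary policy induces an irreducible and aperiodic
Markov chain. -/
def MDP.IsErgodic {S A : Type*} [Fintype S] [DecidableEq S] (𝓜 : MDP S A) : Prop :=
  ∀ β : 𝓜.Policy, (𝓜.chain β).IsIrreducible ∧ IsAperiodic (𝓜.chain β)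

/-- `π` is a stationary distribution of the transition matrix `P`. -/
def IsStationary {S : Type*} [Fintype S] (P : Matrix S S ℝ) (π : S → ℝ) : Prop :=
  (∀ s, 0 ≤ π s) ∧ ∑ s, π s = 1 ∧ π ᵥ* P = π

/-- The stationary distribution `π_β` of a policy (it exists and is unique in an ergodic MDP). -/
def MDP.stationaryDist {S A : Type*} [Fintype S] (𝓜 : MDP S A) (β : 𝓜.Policy) : S → ℝ :=
  Classical.epsilon (IsStationary (𝓜.chain β))

/-- Total variation distance `max_E |p(E) - q(E)|` between distributions on a finite set. -/
def tvDist {S : Type*} [Fintype S] (p q : S → ℝ) : ℝ :=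
  ⨆ E : Finset S, |∑ s ∈ E, p s - ∑ s ∈ E, q s|

/-- `max_{s, s'} ‖P(s', ·) - P(s, ·)‖_TV`. -/
def contraction {S : Type*} [Fintype S] (P : Matrix S S ℝ) : ℝ :=
  ⨆ s : S, ⨆ s' : S, tvDist (P s') (P s)

/-! ### The average reward linear program -/

/-- Feasible points `π(s, a)`, `a ∈ act s`, of the average reward LP. -/
def MDP.LPFeasible {S A : Type*} [Fintype S] (𝓜 : MDP S A) (π : S → A → ℝ) : Prop :=
  (∀ s, ∀ a ∈ 𝓜.act s, 0 ≤ π s a) ∧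
  (∑ s, ∑ a ∈ 𝓜.act s, π s a = 1) ∧
  (∀ s', ∑ a ∈ 𝓜.act s', π s' a = ∑ s, ∑ a ∈ 𝓜.act s, π s a * 𝓜.trans s a s')

/-- Objective of the LP for action rewards `r`. -/
def MDP.lpValue {S A : Type*} [Fintype S] (𝓜 : MDP S A) (r : A → ℝ) (π : S → A → ℝ) : ℝ :=
  ∑ s, ∑ a ∈ 𝓜.act s, π s a * r a

/-- `π` solves the LP with action rewards `r`. -/
def MDP.IsLPSolution {S A : Type*} [Fintype S] (𝓜 : MDP S A) (r : A → ℝ) (π : S → A → ℝ) : Prop :=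
  𝓜.LPFeasible π ∧ ∀ π', 𝓜.LPFeasible π' → 𝓜.lpValue r π' ≤ 𝓜.lpValue r π

/-- `β` is obtained from some solution `π` of the LP by `β(s) ∈ argmax_{a ∈ act s} π(s, a)`. -/
def MDP.IsLPPolicy {S A : Type*} [Fintype S] (𝓜 : MDP S A) (r : A → ℝ) (β : 𝓜.Policy) : Prop :=
  ∃ π, 𝓜.IsLPSolution r π ∧ ∀ s, ∀ a ∈ 𝓜.act s, π s a ≤ π s (β s)

/-! ### Multi-channel quantities, for a matrix `m` of mean rates `m j a` -/

/-- Mean rate of channel `j` under action `a`, for gain laws `ν j` and rate function `f`. -/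
def meanRate {A 𝒳 : Type*} [MeasurableSpace 𝒳] {M : ℕ} (f : A → 𝒳 → ℝ)
    (ν : Fin M → Measure 𝒳) (j : Fin M) (a : A) : ℝ :=
  ∫ x, f a x ∂(ν j)

/-- `φ*(a)`: a channel of maximal mean rate for the action `a`. -/
def bestChannel {A : Type*} {M : ℕ} [NeZero M] (m : Fin M → A → ℝ) (a : A) : Fin M :=
  (Finite.exists_max fun j => m j a).choose

/-- `μ*(a)`: the mean rate of the best channel for `a`. -/
def bestRate {A : Type*} {M : ℕ} [NeZero M] (m : Fin M → A → ℝ) (a : A) : ℝ :=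
  m (bestChannel m a) a

/-- `ρ(β, φ, m) = ∑_s π_β(s) m_{φ(β(s))}(β(s))`. -/
def MDP.avgRate {S A : Type*} [Fintype S] (𝓜 : MDP S A) {M : ℕ} (m : Fin M → A → ℝ)
    (β : 𝓜.Policy) (φ : A → Fin M) : ℝ :=
  ∑ s, 𝓜.stationaryDist β s * m (φ (β s)) (β s)

/-- `β*`: a policy of maximal average rate under the best channel mapping `φ*`. -/
def MDP.bestPolicy {S A : Type*} [Fintype S] [Finite A] (𝓜 : MDP S A) {M : ℕ} [NeZero M]
    (m : Fin M → A → ℝ) : 𝓜.Policy :=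
  (Finite.exists_max fun β : 𝓜.Policy => 𝓜.avgRate m β (bestChannel m)).choose

/-- `ρ* = ρ(β*, φ*, m)`. -/
def MDP.optRate {S A : Type*} [Fintype S] [Finite A] (𝓜 : MDP S A) {M : ℕ} [NeZero M]
    (m : Fin M → A → ℝ) : ℝ :=
  𝓜.avgRate m (𝓜.bestPolicy m) (bestChannel m)

/-- `γ = max_{s, s'} ‖P_*(s', ·) - P_*(s, ·)‖_TV`, with `P_*` the chain of `β*`. -/
def MDP.gamma {S A : Type*} [Fintype S] [Finite A] (𝓜 : MDP S A) {M : ℕ} [NeZero M]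
    (m : Fin M → A → ℝ) : ℝ :=
  contraction (𝓜.chain (𝓜.bestPolicy m))

/-- `μ_max = max_a μ*(a)`. -/
def muMax {A : Type*} {M : ℕ} [NeZero M] (m : Fin M → A → ℝ) : ℝ :=
  ⨆ a, bestRate m a

/-- `Δ_max = ρ* - min_{a, j} μ_j(a)`. -/
def MDP.deltaMax {S A : Type*} [Fintype S] [Finite A] (𝓜 : MDP S A) {M : ℕ} [NeZero M]
    (m : Fin M → A → ℝ) : ℝ :=
  𝓜.optRate m - ⨅ p : A × Fin M, m p.2 p.1

/-- `Δ₃`: the smallest gap `μ*(a) - μ_j(a)` over actions `a` and channels `j` that are not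
optimal for `a` (`⊤` if there are none). -/
def delta3 {A : Type*} {M : ℕ} [NeZero M] (m : Fin M → A → ℝ) : EReal :=
  ⨅ (a : A) (j : Fin M) (_ : m j a < bestRate m a), ((bestRate m a - m j a : ℝ) : EReal)

/-- `Δ₄ = ρ* - max_{β ≠ β*} ρ(β, φ*, m)` (`⊤` if there is only one policy). -/
def MDP.delta4 {S A : Type*} [Fintype S] [Finite A] (𝓜 : MDP S A) {M : ℕ} [NeZero M]
    (m : Fin M → A → ℝ) : EReal :=
  ⨅ (β : 𝓜.Policy) (_ : β ≠ 𝓜.bestPolicy m),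
    ((𝓜.optRate m - 𝓜.avgRate m β (bestChannel m) : ℝ) : EReal)

/-- `B₀ = max_a (sup_x f(a, x) - inf_x f(a, x))`. -/
def rateRange {A 𝒳 : Type*} (f : A → 𝒳 → ℝ) : ℝ :=
  ⨆ a, ((⨆ x, f a x) - ⨅ x, f a x)

/-- `c_(x) = ∑_{t ≥ 1} t^{-x}`. -/
def zetaSum (x : ℝ) : ℝ := ∑' t : ℕ, ((t : ℝ) + 1) ^ (-x)

/-! ### The algorithm; time slots are `1, 2, 3, …` -/

/-- `R` is a set of slots built by the rule: a slot `t > 1` belongs to `R` if and only if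
`|R ∩ [1, t - 1]| < M ⌈w ln t⌉`. (Slot `1` may or may not belong to `R`.) -/
def IsExplorationSequence (M : ℕ) (w : ℝ) (R : Set ℕ) : Prop :=
  0 ∉ R ∧ ∀ t : ℕ, 1 < t →
    (t ∈ R ↔ ((R ∩ Set.Icc 1 (t - 1)).ncard : ℤ) < M * ⌈w * Real.log t⌉)

/-- The channel explored in slot `n` when `n` is an exploration slot: channel `(n - 1) mod M`,
where the channels are numbered `0, …, M - 1`. -/
def roundRobin (M : ℕ) [NeZero M] (n : ℕ) : Fin M := Fin.ofNat M (n - 1)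

open Classical in
/-- `m_j` after slot `n`: how often channel `j` has been explored. -/
def exploreCount {M : ℕ} [NeZero M] (R : Set ℕ) : ℕ → Fin M → ℕ
  | 0, _ => 0
  | n + 1, j =>
    if n + 1 ∈ R ∧ roundRobin M (n + 1) = j then exploreCount R n j + 1 else exploreCount R n j

open Classical in
/-- `θ_j(a)` after slot `n`, where `x n j` is the gain of channel `j` in slot `n`. -/
def estimate {A 𝒳 : Type*} {M : ℕ} [NeZero M] (f : A → 𝒳 → ℝ) (R : Set ℕ)
    (x : ℕ → Fin M → 𝒳) : ℕ → Fin M → A → ℝ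
  | 0, _, _ => 0
  | n + 1, j, a =>
    if n + 1 ∈ R ∧ roundRobin M (n + 1) = j then
      (exploreCount R n j * estimate f R x n j a + f a (x (n + 1) j)) / (exploreCount R n j + 1)
    else estimate f R x n j a

/-- The random environment together with an agent acting in it. `ℱ n` is the information
available when the decision of slot `n` is taken (it may contain additional randomization),
`X n j` the gain of channel `j` in slot `n`, and `st n`, `ac n`, `ch n` the state, action and
channel of slot `n`. The gains of slot `n` are independent of `ℱ n`, and channel `j` has gain law
`ν j` in every slot, so that the gains are i.i.d. over time. -/
structure IsControlledSystem {S A 𝒳 Ω : Type*} [Fintype S] [MeasurableSpace 𝒳]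
    {mΩ : MeasurableSpace Ω} {M : ℕ} (𝓜 : MDP S A) (ν : Fin M → Measure 𝒳) (Pr : Measure Ω)
    (ℱ : Filtration ℕ mΩ) (X : ℕ → Ω → Fin M → 𝒳) (st : ℕ → Ω → S) (ac : ℕ → Ω → A)
    (ch : ℕ → Ω → Fin M) : Prop where
  state_adapted : ∀ n, 1 ≤ n → ∀ s, MeasurableSet[ℱ n] {ω | st n ω = s}
  action_adapted : ∀ n, 1 ≤ n → ∀ a, MeasurableSet[ℱ n] {ω | ac n ω = a}
  channel_adapted : ∀ n, 1 ≤ n → ∀ j, MeasurableSet[ℱ n] {ω | ch n ω = j}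
  action_valid : ∀ n, 1 ≤ n → ∀ ω, ac n ω ∈ 𝓜.act (st n ω)
  gain_observed : ∀ n, 1 ≤ n → Measurable[ℱ (n + 1)] (X n)
  gain_law : ∀ n, 1 ≤ n → ∀ j, Pr.map (fun ω => X n ω j) = ν j
  gain_indep : ∀ n, 1 ≤ n → Indep (MeasurableSpace.comap (X n) inferInstance) (ℱ n) Pr
  transition : ∀ n, 1 ≤ n → ∀ s',
    Pr[({ω | st (n + 1) ω = s'}.indicator fun _ => (1 : ℝ)) | ℱ n]
      =ᵐ[Pr] fun ω => 𝓜.trans (st n ω) (ac n ω) s'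

/-- The agent follows MC-LPSM with exploration slots `R`. In an exploitation slot `n`, `β n` and
`φ n` are the power and channel selection policies in force. Ties in the maximizations are broken
arbitrarily. In slot `1`, if it is not an exploration slot, `β 1` and `φ 1` are arbitrary. -/
structure IsMCLPSM {S A 𝒳 Ω : Type*} [Fintype S] {mΩ : MeasurableSpace Ω} {M : ℕ} [NeZero M]
    (𝓜 : MDP S A) (f : A → 𝒳 → ℝ) (R : Set ℕ) (ℱ : Filtration ℕ mΩ)
    (X : ℕ → Ω → Fin M → 𝒳) (st : ℕ → Ω → S) (ac : ℕ → Ω → A) (ch : ℕ → Ω → Fin M)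
    (β : ℕ → Ω → 𝓜.Policy) (φ : ℕ → Ω → A → Fin M) : Prop where
  /-- round-robin exploration (with any valid action) -/
  explore : ∀ n, 1 ≤ n → n ∈ R → ∀ ω, ch n ω = roundRobin M n
  policy_adapted : ∀ n, 1 ≤ n → n ∉ R → ∀ b, MeasurableSet[ℱ n] {ω | β n ω = b}
  mapping_adapted : ∀ n, 1 ≤ n → n ∉ R → ∀ p, MeasurableSet[ℱ n] {ω | φ n ω = p}
  /-- right after an exploration slot, `φ` picks the empirically best channels … -/
  mapping_update : ∀ n, 2 ≤ n → n ∉ R → n - 1 ∈ R → ∀ ω a j,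
    estimate f R (fun k => X k ω) (n - 1) j a
      ≤ estimate f R (fun k => X k ω) (n - 1) (φ n ω a) a
  /-- … and `β` is computed from the LP with the estimated rates of these channels -/
  policy_update : ∀ n, 2 ≤ n → n ∉ R → n - 1 ∈ R → ∀ ω,
    𝓜.IsLPPolicy (fun a => estimate f R (fun k => X k ω) (n - 1) (φ n ω a) a) (β n ω)
  /-- otherwise the policies of the previous exploitation slot are kept -/
  keep : ∀ n, 2 ≤ n → n ∉ R → n - 1 ∉ R → ∀ ω,
    β n ω = β (n - 1) ω ∧ φ n ω = φ (n - 1) ω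
  exploit : ∀ n, 1 ≤ n → n ∉ R → ∀ ω,
    ac n ω = β n ω (st n ω) ∧ ch n ω = φ n ω (ac n ω)

/-- Expected `T`-slot regret with respect to the benchmark mean rate `ρ`. -/
def regret {A 𝒳 Ω : Type*} [MeasurableSpace Ω] {M : ℕ} (Pr : Measure Ω) (f : A → 𝒳 → ℝ) (ρ : ℝ)
    (X : ℕ → Ω → Fin M → 𝒳) (ac : ℕ → Ω → A) (ch : ℕ → Ω → Fin M) (T : ℕ) : ℝ :=
  T * ρ - ∫ ω, ∑ n ∈ Finset.Icc 1 T, f (ac n ω) (X n ω (ch n ω)) ∂Pr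

/-! ### The energy harvesting transmitter as an instance -/

/-- The battery MDP: states and transmit powers are `0, …, Q`, the transmit power is at most the
stored energy and positive if the latter is, and the battery level is updated by
`s' = min (s - a + p) Q`, where `p` is the harvested power with distribution `harvest`. -/
def batteryMDP (Q : ℕ) (harvest : PMF ℕ) : MDP (Fin (Q + 1)) (Fin (Q + 1)) where
  act s := {a | a ≤ s ∧ (0 < s → 0 < a)}
  act_nonempty s := ⟨s, by simp⟩
  trans s a s' := ((harvest.map fun p =>
    (⟨min ((s : ℕ) - a + p) Q, by omega⟩ : Fin (Q + 1))) s').toReal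
  trans_nonneg _ _ _ _ := ENNReal.toReal_nonneg
  trans_sum s a _ := by
    rw [← ENNReal.toReal_sum fun _ _ => PMF.apply_ne_top _ _, ← tsum_fintype (L := .unconditional _),
      PMF.tsum_coe, ENNReal.toReal_one]

lemma batteryMDP_trans_pos {Q : ℕ} {harvest : PMF ℕ} (s a s' : Fin (Q + 1)) (p : ℕ)
    (hp : harvest p ≠ 0) (h : min ((s : ℕ) - a + p) Q = s') :
    0 < (batteryMDP Q harvest).trans s a s' := by
  refine ENNReal.toReal_pos ?_ (PMF.apply_ne_top _ _)
  rw [← PMF.mem_support_iff, PMF.mem_support_map_iff]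
  exact ⟨p, (PMF.mem_support_iff _ _).2 hp, Fin.ext h⟩

/-- The battery MDP is ergodic if every harvest level `0, …, Q` has positive probability. -/
theorem batteryMDP_isErgodic {Q : ℕ} {harvest : PMF ℕ} (hp : ∀ p ≤ Q, harvest p ≠ 0) :
    (batteryMDP Q harvest).IsErgodic := by
  intro β
  set P := (batteryMDP Q harvest).chain β with hP
  have hβ : ∀ s : Fin (Q + 1), ((β s : Fin (Q + 1)) : ℕ) ≤ s ∧
      (0 < (s : ℕ) → 0 < ((β s : Fin (Q + 1)) : ℕ)) := by
    intro s
    have h := (β s).2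
    simp only [batteryMDP, Finset.mem_filter, Finset.mem_univ, true_and] at h
    exact ⟨h.1, fun h0 => h.2 h0⟩
  have hnn : ∀ s s', 0 ≤ P s s' := fun s s' => ENNReal.toReal_nonneg
  have hup : ∀ s s' : Fin (Q + 1), (s : ℕ) ≤ s' → 0 < P s s' := by
    intro s s' hs
    have h1 := hβ s
    refine batteryMDP_trans_pos s (β s) s' (s' - (s - (β s : Fin (Q + 1)))) (hp _ ?_) ?_ <;> omega
  have hdown : ∀ s s' : Fin (Q + 1), (s : ℕ) = s' + 1 → 0 < P s s' := by
    intro s s' hs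
    have h1 := hβ s
    refine batteryMDP_trans_pos s (β s) s' ((β s : Fin (Q + 1)) - 1) (hp _ ?_) ?_ <;> omega
  have hpow : ∀ k : ℕ, ∀ s s' : Fin (Q + 1), (s : ℕ) = s' + k → 0 < (P ^ (k + 1)) s s' := by
    intro k
    induction k with
    | zero => intro s s' h; simpa using hup s s' (by omega)
    | succ k ih =>
      intro s s' h
      rw [pow_succ', Matrix.mul_apply]
      refine Finset.sum_pos' (fun i _ => mul_nonneg (hnn _ _) (Matrix.pow_apply_nonneg hnn _ _ _))
        ⟨⟨s - 1, by omega⟩, Finset.mem_univ _, mul_pos (hdown _ _ ?_) (ih _ _ ?_)⟩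
      · simp only; omega
      · simp only; omega
  refine ⟨(Matrix.isIrreducible_iff_exists_pow_pos hnn).2 fun s s' => ?_, fun s k hk => ?_⟩
  · rcases le_total (s : ℕ) s' with h | h
    · exact ⟨1, one_pos, by simpa using hup s s' h⟩
    · exact ⟨s - s' + 1, by omega, hpow _ _ _ (by omega)⟩
  · simpa using hk 1 le_rfl (by simpa using hup s s le_rfl)

lemma sum_sub_sum_lt_one {S : Type*} [Fintype S] {p q : S → ℝ} (hp : ∀ s, 0 ≤ p s)
    (hq : ∀ s, 0 ≤ q s) (hp1 : ∑ s, p s = 1) {s₀ : S} (hps : 0 < p s₀) (hqs : 0 < q s₀)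
    (E : Finset S) : ∑ s ∈ E, p s - ∑ s ∈ E, q s < 1 := by
  classical
  by_cases h : s₀ ∈ E
  · have h1 := Finset.sum_le_univ_sum_of_nonneg (s := E) hp
    have h2 := Finset.single_le_sum (fun s _ => hq s) h
    linarith
  · have h1 := Finset.sum_le_univ_sum_of_nonneg (s := insert s₀ E) hp
    rw [Finset.sum_insert h] at h1
    have h2 := Finset.sum_nonneg fun s (_ : s ∈ E) => hq s
    linarith

/-- In the battery MDP, `γ < 1` holds automatically. -/
theorem batteryMDP_contraction_lt_one {Q : ℕ} {harvest : PMF ℕ} (hp : ∀ p ≤ Q, harvest p ≠ 0)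
    (β : (batteryMDP Q harvest).Policy) : contraction ((batteryMDP Q harvest).chain β) < 1 := by
  set P := (batteryMDP Q harvest).chain β with hP
  have hnn : ∀ s s', 0 ≤ P s s' := fun s s' => ENNReal.toReal_nonneg
  have hsum : ∀ s, ∑ s', P s s' = 1 := fun s => (batteryMDP Q harvest).trans_sum s (β s) (β s).2
  have hlast : ∀ s, 0 < P s (Fin.last Q) := fun s =>
    batteryMDP_trans_pos s (β s) (Fin.last Q) Q (hp Q le_rfl) (by simp)
  unfold contraction
  obtain ⟨s, hs⟩ := exists_eq_ciSup_of_finite (f := fun s => ⨆ s', tvDist (P s') (P s))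
  rw [← hs]
  obtain ⟨s', hs'⟩ := exists_eq_ciSup_of_finite (f := fun s' => tvDist (P s') (P s))
  simp only [← hs']
  unfold tvDist
  obtain ⟨E, hE⟩ := exists_eq_ciSup_of_finite
    (f := fun E : Finset (Fin (Q + 1)) => |∑ x ∈ E, P s' x - ∑ x ∈ E, P s x|)
  rw [← hE, abs_lt]
  have h1 := sum_sub_sum_lt_one (hnn s') (hnn s) (hsum s') (hlast s') (hlast s) E
  have h2 := sum_sub_sum_lt_one (hnn s) (hnn s') (hsum s) (hlast s) (hlast s') E
  constructor <;> linarith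

end

end MCLPSM

open MCLPSM

/-!
Let `h` be a bias function of `β*`, i.e. a solution of the Poisson equation
`μ*(β*(s)) + ∑ s', P_*(s, s') h(s') = ρ* + h(s)`. The contraction `γ < 1` makes it exist and bounds
its oscillation by `D = μ_max / (1 - γ)`. A slot in which action and channel are optimal then loses
in expectation only the increment of `h`, which telescopes, and any other slot loses at most
`Δ_max + D` more; hence the regret is at most `D + (Δ_max + D) ∑ Pr(suboptimal decision in slot n)`.

There are at most `M ⌈w ln T⌉` exploration slots after slot `1`. Before an exploitation slot `n` the
round robin has sampled each channel at least `⌈w ln n⌉` times, so by Hoeffding's inequality and a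
union bound some estimate is off by `d / 2` or more with probability at most
`2 A M n ^ (-w d² / (2 B₀²))`. Otherwise `d ≤ Δ₃` makes the empirically best channels optimal, and
`d ≤ Δ₄` makes `β*` the unique best policy for the estimated rates. All other actions then have
negative advantage with respect to `β*`, so by complementary slackness every solution of the LP is
supported on `β*`; being stationary for an irreducible chain it is positive there, and the argmax
returns `β*`.
-/

namespace MCLPSM

/-! ### Stationary distributions -/

section Stationary

variable {S : Type*} [Fintype S] {P : Matrix S S ℝ}

lemma exists_ne_zero_vecMul_eq_self [Nonempty S] (hP1 : ∀ s, ∑ s', P s s' = 1) :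
    ∃ v : S → ℝ, v ≠ 0 ∧ v ᵥ* P = v := by
  classical
  have hdet : (1 - P).det = 0 := by
    refine Matrix.exists_mulVec_eq_zero_iff.1 ⟨1, one_ne_zero, ?_⟩
    ext s
    rw [Matrix.sub_mulVec, Matrix.one_mulVec]
    simp [Matrix.mulVec, dotProduct_one, hP1]
  obtain ⟨v, hv0, hv⟩ := Matrix.exists_vecMul_eq_zero_iff.2 hdet
  rw [Matrix.vecMul_sub, Matrix.vecMul_one, sub_eq_zero] at hv
  exact ⟨v, hv0, hv.symm⟩

lemma abs_vecMul_eq_self (hP : ∀ s s', 0 ≤ P s s') (hP1 : ∀ s, ∑ s', P s s' = 1) {v : S → ℝ}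
    (hv : v ᵥ* P = v) : |v| ᵥ* P = |v| := by
  have hle : ∀ s', |v| s' ≤ (|v| ᵥ* P) s' := fun s' => calc
    |v s'| = |∑ s, v s * P s s'| := congrArg _ (congrFun hv s').symm
    _ ≤ ∑ s, |v s * P s s'| := Finset.abs_sum_le_sum_abs _ _
    _ = ∑ s, |v s| * P s s' := by simp only [abs_mul, abs_of_nonneg (hP _ _)]
  have hsum : ∑ s', |v| s' = ∑ s', (|v| ᵥ* P) s' := by
    simp only [Matrix.vecMul, dotProduct]
    rw [Finset.sum_comm]
    simp only [← Finset.mul_sum, hP1, mul_one]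
  ext s'
  exact ((Finset.sum_eq_sum_iff_of_le fun s' _ => hle s').1 hsum s' (Finset.mem_univ s')).symm

theorem exists_isStationary [Nonempty S] (hP : ∀ s s', 0 ≤ P s s')
    (hP1 : ∀ s, ∑ s', P s s' = 1) : ∃ π, IsStationary P π := by
  obtain ⟨v, hv0, hv⟩ := exists_ne_zero_vecMul_eq_self hP1
  have hpos : 0 < ∑ s, |v| s := by
    obtain ⟨s, hs⟩ := Function.ne_iff.1 hv0
    exact Finset.sum_pos' (fun _ _ => abs_nonneg _) ⟨s, Finset.mem_univ _, abs_pos.2 hs⟩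
  refine ⟨(∑ s, |v| s)⁻¹ • |v|, fun s => mul_nonneg (inv_nonneg.2 hpos.le) (abs_nonneg _), ?_, ?_⟩
  · simp only [Pi.smul_apply, smul_eq_mul, ← Finset.mul_sum, inv_mul_cancel₀ hpos.ne']
  · rw [Matrix.smul_vecMul, abs_vecMul_eq_self hP hP1 hv]

namespace IsStationary

variable {π : S → ℝ}

lemma dotProduct_mulVec (hπ : IsStationary P π) (g : S → ℝ) : π ⬝ᵥ P *ᵥ g = π ⬝ᵥ g := by
  rw [Matrix.dotProduct_mulVec, hπ.2.2]

lemma dotProduct_const (hπ : IsStationary P π) (c : ℝ) : (π ⬝ᵥ fun _ => c) = c := by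
  simp only [dotProduct, ← Finset.sum_mul, hπ.2.1, one_mul]

lemma abs_dotProduct_sub_dotProduct_lt (hπ : IsStationary P π) {g h : S → ℝ} {ε : ℝ}
    (hgh : ∀ s, |g s - h s| < ε) : |π ⬝ᵥ g - π ⬝ᵥ h| < ε := by
  rw [← dotProduct_sub]
  simpa [dotProduct] using (convex_ball (0 : ℝ) ε).sum_mem (fun s _ => hπ.1 s) hπ.2.1
    (z := g - h) fun s _ => by simpa using hgh s

theorem pos (hπ : IsStationary P π) (hP : P.IsIrreducible) (s : S) : 0 < π s := by
  classical
  have hpow : ∀ n : ℕ, π ᵥ* P ^ n = π := fun n => by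
    induction n with
    | zero => simp
    | succ n ih => rw [pow_succ, ← Matrix.vecMul_vecMul, ih, hπ.2.2]
  obtain ⟨s₀, -, hs₀⟩ : ∃ s₀ ∈ Finset.univ, 0 < π s₀ :=
    Finset.exists_lt_of_sum_lt (by simp [hπ.2.1])
  obtain ⟨n, -, hn⟩ := (Matrix.isIrreducible_iff_exists_pow_pos hP.nonneg).1 hP s₀ s
  calc 0 < ∑ i, π i * (P ^ n) i s :=
        Finset.sum_pos' (fun i _ => mul_nonneg (hπ.1 i) (Matrix.pow_apply_nonneg hP.nonneg n i s))
          ⟨s₀, Finset.mem_univ _, mul_pos hs₀ hn⟩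
    _ = π s := congrFun (hpow n) s

end IsStationary

end Stationary

/-! ### The Poisson equation -/

section Poisson

variable {S : Type*} [Fintype S]

lemma abs_sum_sub_sum_le_tvDist (p q : S → ℝ) (E : Finset S) :
    |∑ s ∈ E, p s - ∑ s ∈ E, q s| ≤ tvDist p q :=
  le_ciSup (f := fun E : Finset S => |∑ s ∈ E, p s - ∑ s ∈ E, q s|) (Set.finite_range _).bddAbove E

lemma tvDist_le_contraction (P : Matrix S S ℝ) (s s' : S) :
    tvDist (P s') (P s) ≤ contraction P :=
  (le_ciSup (f := fun s' => tvDist (P s') (P s)) (Set.finite_range _).bddAbove s').trans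
    (le_ciSup (f := fun s => ⨆ s', tvDist (P s') (P s)) (Set.finite_range _).bddAbove s)

theorem dotProduct_sub_dotProduct_le_tvDist_mul {p q : S → ℝ} (hpq : ∑ s, p s = ∑ s, q s)
    {g : S → ℝ} {K : ℝ} (hK : 0 ≤ K) (hg : ∀ s s', g s - g s' ≤ K) :
    p ⬝ᵥ g - q ⬝ᵥ g ≤ tvDist p q * K := by
  classical
  obtain hS | hS := isEmpty_or_nonempty S
  · have := abs_sum_sub_sum_le_tvDist p q ∅
    simpa using mul_nonneg ((abs_nonneg _).trans this) hK
  obtain ⟨s₀, hs₀⟩ := Finite.exists_min g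
  set E : Finset S := {s | q s ≤ p s}
  calc p ⬝ᵥ g - q ⬝ᵥ g
      = ∑ s, (p s - q s) * (g s - g s₀) + (∑ s, p s - ∑ s, q s) * g s₀ := by
        rw [dotProduct, dotProduct, ← Finset.sum_sub_distrib, ← Finset.sum_sub_distrib,
          Finset.sum_mul, ← Finset.sum_add_distrib]
        exact Finset.sum_congr rfl fun s _ => by ring
    _ = ∑ s, (p s - q s) * (g s - g s₀) := by rw [hpq, sub_self, zero_mul, add_zero]
    _ ≤ ∑ s ∈ E, (p s - q s) * K := by
        rw [Finset.sum_filter]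
        refine Finset.sum_le_sum fun s _ => ?_
        split_ifs with h
        · exact mul_le_mul_of_nonneg_left (hg _ _) (sub_nonneg.2 h)
        · exact mul_nonpos_of_nonpos_of_nonneg (by linarith) (sub_nonneg.2 (hs₀ s))
    _ = (∑ s ∈ E, p s - ∑ s ∈ E, q s) * K := by rw [← Finset.sum_mul, Finset.sum_sub_distrib]
    _ ≤ tvDist p q * K :=
        mul_le_mul_of_nonneg_right ((le_abs_self _).trans (abs_sum_sub_sum_le_tvDist p q E)) hK

lemma mulVec_sub_mulVec_le_contraction_mul {P : Matrix S S ℝ} (hP1 : ∀ s, ∑ s', P s s' = 1)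
    {g : S → ℝ} {K : ℝ} (hg : ∀ s s', g s - g s' ≤ K) (s s' : S) :
    (P *ᵥ g) s - (P *ᵥ g) s' ≤ contraction P * K :=
  have hK : 0 ≤ K := by simpa using hg s s
  (dotProduct_sub_dotProduct_le_tvDist_mul ((hP1 s).trans (hP1 s').symm) hK hg).trans
    (mul_le_mul_of_nonneg_right (tvDist_le_contraction P s' s) hK)

/-- The Poisson equation `r + P h = ρ + h` of a Markov chain with transition matrix `P` and state
rewards `r`, in the average reward `ρ` and the bias (relative value) function `h`. -/
def SolvesPoisson (P : Matrix S S ℝ) (r : S → ℝ) (ρ : ℝ) (h : S → ℝ) : Prop :=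
  ∀ s, r s + (P *ᵥ h) s = ρ + h s

theorem SolvesPoisson.sub_le {P : Matrix S S ℝ} {r h : S → ℝ} {ρ K : ℝ}
    (hh : SolvesPoisson P r ρ h) (hP1 : ∀ s, ∑ s', P s s' = 1) (hγ : contraction P < 1)
    (hr : ∀ s s', r s - r s' ≤ K) (s s' : S) : h s - h s' ≤ K / (1 - contraction P) := by
  have : Nonempty S := ⟨s⟩
  obtain ⟨a, ha⟩ := Finite.exists_max h
  obtain ⟨b, hb⟩ := Finite.exists_min h
  have hosc : ∀ s s', h s - h s' ≤ h a - h b := fun s s' => sub_le_sub (ha s) (hb s')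
  refine (hosc s s').trans ?_
  rw [le_div_iff₀ (by linarith)]
  linarith [mulVec_sub_mulVec_le_contraction_mul hP1 hosc a b, hh a, hh b, hr a b]

lemma eq_of_mulVec_eq_self {P : Matrix S S ℝ} (hP1 : ∀ s, ∑ s', P s s' = 1)
    (hγ : contraction P < 1) {h : S → ℝ} (hh : P *ᵥ h = h) (s s' : S) : h s = h s' := by
  have hpoisson : SolvesPoisson P 0 0 h := fun s => by simp [hh]
  have hle : ∀ s s', h s - h s' ≤ 0 := fun s s' => by
    simpa using hpoisson.sub_le hP1 hγ (K := 0) (by simp) s s'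
  linarith [hle s s', hle s' s]

lemma one_sub_add_vecMulVec_mulVec [DecidableEq S] (P : Matrix S S ℝ) (π h : S → ℝ) :
    (1 - P + Matrix.vecMulVec 1 π) *ᵥ h = h - P *ᵥ h + fun _ => π ⬝ᵥ h := by
  rw [Matrix.add_mulVec, Matrix.sub_mulVec, Matrix.one_mulVec, Matrix.vecMulVec_mulVec]
  ext s
  simp

namespace IsStationary

variable {P : Matrix S S ℝ} {π : S → ℝ}

lemma dotProduct_one_sub_add_vecMulVec_mulVec [DecidableEq S] (hπ : IsStationary P π) (h : S → ℝ) :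
    π ⬝ᵥ (1 - P + Matrix.vecMulVec 1 π) *ᵥ h = π ⬝ᵥ h := by
  rw [one_sub_add_vecMulVec_mulVec, dotProduct_add, dotProduct_sub, hπ.dotProduct_mulVec,
    hπ.dotProduct_const, sub_self, zero_add]

lemma isUnit_one_sub_add_vecMulVec [DecidableEq S] (hπ : IsStationary P π)
    (hP1 : ∀ s, ∑ s', P s s' = 1) (hγ : contraction P < 1) :
    IsUnit (1 - P + Matrix.vecMulVec 1 π) := by
  refine Matrix.mulVec_injective_iff_isUnit.1
    ((injective_iff_map_eq_zero (1 - P + Matrix.vecMulVec 1 π).mulVecLin).2 fun h hh => ?_)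
  rw [Matrix.mulVecLin_apply] at hh
  have hπh : π ⬝ᵥ h = 0 := by
    rw [← hπ.dotProduct_one_sub_add_vecMulVec_mulVec, hh, dotProduct_zero]
  have hharmonic : P *ᵥ h = h := by
    ext s
    have := congrFun hh s
    simp only [one_sub_add_vecMulVec_mulVec, hπh, Pi.add_apply, Pi.sub_apply, Pi.zero_apply] at this
    linarith
  ext s
  have hconst : h = fun _ => h s := funext fun s' => eq_of_mulVec_eq_self hP1 hγ hharmonic s' s
  rwa [hconst, hπ.dotProduct_const] at hπh

theorem exists_solvesPoisson (hπ : IsStationary P π) (hP1 : ∀ s, ∑ s', P s s' = 1)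
    (hγ : contraction P < 1) (r : S → ℝ) : ∃ h, SolvesPoisson P r (π ⬝ᵥ r) h := by
  classical
  obtain ⟨h, hh⟩ :=
    Matrix.mulVec_surjective_iff_isUnit.2 (hπ.isUnit_one_sub_add_vecMulVec hP1 hγ) r
  have hπr : π ⬝ᵥ r = π ⬝ᵥ h := by rw [← hh, hπ.dotProduct_one_sub_add_vecMulVec_mulVec]
  refine ⟨h, fun s => ?_⟩
  have := congrFun hh s
  simp only [one_sub_add_vecMulVec_mulVec, Pi.add_apply, Pi.sub_apply] at this
  linarith

end IsStationary

end Poisson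

/-! ### The average reward linear program -/

namespace MDP

variable {S A : Type*} [Fintype S] {𝓜 : MDP S A}

lemma chain_nonneg (β : 𝓜.Policy) (s s' : S) : 0 ≤ 𝓜.chain β s s' :=
  𝓜.trans_nonneg s _ (β s).2 s'

lemma chain_sum (β : 𝓜.Policy) (s : S) : ∑ s', 𝓜.chain β s s' = 1 :=
  𝓜.trans_sum s _ (β s).2

lemma isStationary_stationaryDist [Nonempty S] (β : 𝓜.Policy) :
    IsStationary (𝓜.chain β) (𝓜.stationaryDist β) :=
  Classical.epsilon_spec (exists_isStationary (chain_nonneg β) (chain_sum β))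

/-- The long-run average reward of the policy `β` for action rewards `r`. For a channel mapping `φ`
and mean rates `m`, the rate `𝓜.avgRate m β φ` is the case `r a = m (φ a) a`. -/
noncomputable def avgReward (𝓜 : MDP S A) (r : A → ℝ) (β : 𝓜.Policy) : ℝ :=
  𝓜.stationaryDist β ⬝ᵥ fun s => r (β s)

/-- The advantage of action `a` in state `s` relative to a bias function `h` and an average reward
`ρ`: what choosing `a` once gains over a policy whose Poisson equation is solved by `ρ` and `h`. -/
noncomputable def advantage (𝓜 : MDP S A) (r : A → ℝ) (h : S → ℝ) (ρ : ℝ) (s : S) (a : A) : ℝ :=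
  r a + 𝓜.trans s a ⬝ᵥ h - h s - ρ

open Classical in
/-- The state-action frequencies of the policy `β` when the states have frequencies `π`. For a
stationary distribution `π` of `β` they form a feasible point of the linear program. -/
noncomputable def occupation (𝓜 : MDP S A) (β : 𝓜.Policy) (π : S → ℝ) (s : S) (a : A) : ℝ :=
  if a = β s then π s else 0

variable {r : A → ℝ} {h : S → ℝ} {ρ : ℝ} {β β₀ : 𝓜.Policy} {π : S → A → ℝ}

lemma sum_occupation_mul (β : 𝓜.Policy) (p : S → ℝ) (s : S) (g : A → ℝ) :
    ∑ a ∈ 𝓜.act s, 𝓜.occupation β p s a * g a = p s * g (β s) := by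
  classical
  simp [occupation]

lemma sum_occupation (β : 𝓜.Policy) (p : S → ℝ) (s : S) :
    ∑ a ∈ 𝓜.act s, 𝓜.occupation β p s a = p s := by
  simpa using sum_occupation_mul β p s 1

lemma lpFeasible_occupation {p : S → ℝ} (hp : IsStationary (𝓜.chain β) p) :
    𝓜.LPFeasible (𝓜.occupation β p) := by
  refine ⟨fun s a _ => ?_, ?_, fun s' => ?_⟩
  · rw [occupation]
    split_ifs
    exacts [hp.1 s, le_rfl]
  · simpa only [sum_occupation] using hp.2.1
  · simp only [sum_occupation, sum_occupation_mul _ _ _ fun a => 𝓜.trans _ a s']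
    exact (congrFun hp.2.2 s').symm

lemma lpValue_occupation (r : A → ℝ) (β : 𝓜.Policy) (p : S → ℝ) :
    𝓜.lpValue r (𝓜.occupation β p) = p ⬝ᵥ fun s => r (β s) := by
  simp only [lpValue, sum_occupation_mul, dotProduct]

lemma LPFeasible.sum_mul_trans_dotProduct (hπ : 𝓜.LPFeasible π) (h : S → ℝ) :
    ∑ s, ∑ a ∈ 𝓜.act s, π s a * (𝓜.trans s a ⬝ᵥ h) = ∑ s, ∑ a ∈ 𝓜.act s, π s a * h s := by
  calc ∑ s, ∑ a ∈ 𝓜.act s, π s a * (𝓜.trans s a ⬝ᵥ h)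
      = ∑ s', (∑ s, ∑ a ∈ 𝓜.act s, π s a * 𝓜.trans s a s') * h s' := by
        simp only [dotProduct, Finset.mul_sum, Finset.sum_mul, ← mul_assoc]
        rw [Finset.sum_comm]
        exact Finset.sum_congr rfl fun s _ => Finset.sum_comm
    _ = ∑ s', ∑ a ∈ 𝓜.act s', π s' a * h s' := by
        simp only [← hπ.2.2, Finset.sum_mul]

theorem LPFeasible.lpValue_eq_add_sum_advantage (hπ : 𝓜.LPFeasible π) (r : A → ℝ) (h : S → ℝ)
    (ρ : ℝ) :
    𝓜.lpValue r π = ρ + ∑ s, ∑ a ∈ 𝓜.act s, π s a * 𝓜.advantage r h ρ s a := by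
  have hρ : ∑ s, ∑ a ∈ 𝓜.act s, π s a * ρ = ρ := by
    simp only [← Finset.sum_mul, hπ.2.1, one_mul]
  simp only [advantage, mul_add, mul_sub, Finset.sum_add_distrib, Finset.sum_sub_distrib,
    hπ.sum_mul_trans_dotProduct, hρ, lpValue]
  ring

lemma dotProduct_eq_add_dotProduct_advantage {p : S → ℝ} (hp : IsStationary (𝓜.chain β) p)
    (r : A → ℝ) (h : S → ℝ) (ρ : ℝ) :
    (p ⬝ᵥ fun s => r (β s)) = ρ + p ⬝ᵥ fun s => 𝓜.advantage r h ρ s (β s) := by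
  rw [← lpValue_occupation, (lpFeasible_occupation hp).lpValue_eq_add_sum_advantage r h ρ]
  simp only [sum_occupation_mul, dotProduct]

lemma advantage_self (hh : SolvesPoisson (𝓜.chain β) (fun s => r (β s)) ρ h) (s : S) :
    𝓜.advantage r h ρ s (β s) = 0 := by
  have : r (β s) + 𝓜.trans s (β s) ⬝ᵥ h = ρ + h s := hh s
  rw [advantage]
  linarith

theorem advantage_neg_of_unique
    (hh : SolvesPoisson (𝓜.chain β₀) (fun s => r (β₀ s)) (𝓜.avgReward r β₀) h)
    (hopt : ∀ β, β ≠ β₀ → 𝓜.avgReward r β < 𝓜.avgReward r β₀) {s : S} {a : A} (ha : a ∈ 𝓜.act s)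
    (hne : a ≠ β₀ s) : 𝓜.advantage r h (𝓜.avgReward r β₀) s a < 0 := by
  classical
  have : Nonempty S := ⟨s⟩
  set ρ := 𝓜.avgReward r β₀
  -- Deviating from `β₀` in the state `s` only isolates the advantage of `a`.
  let β : 𝓜.Policy := Function.update β₀ s ⟨a, ha⟩
  have hβs : β s = ⟨a, ha⟩ := Function.update_self ..
  have hstat := isStationary_stationaryDist β
  have hlt : 𝓜.avgReward r β < ρ := hopt β fun hβ => hne <| by rw [← hβ, hβs]
  have heq : 𝓜.avgReward r β = ρ + 𝓜.stationaryDist β s * 𝓜.advantage r h ρ s a := by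
    rw [avgReward, dotProduct_eq_add_dotProduct_advantage hstat r h ρ, dotProduct,
      Finset.sum_eq_single_of_mem s (Finset.mem_univ s), hβs]
    intro s' _ hs'
    rw [show β s' = β₀ s' from Function.update_of_ne hs' .., advantage_self hh, mul_zero]
  exact neg_of_mul_neg_right (by linarith) (hstat.1 s)

lemma IsLPSolution.eq_zero_of_advantage_neg (hπ : 𝓜.IsLPSolution r π) {p : S → ℝ}
    (hp : IsStationary (𝓜.chain β) p)
    (hh : SolvesPoisson (𝓜.chain β) (fun s => r (β s)) ρ h)
    (hneg : ∀ s, ∀ a ∈ 𝓜.act s, a ≠ β s → 𝓜.advantage r h ρ s a < 0)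
    {s : S} {a : A} (ha : a ∈ 𝓜.act s) (hne : a ≠ β s) : π s a = 0 := by
  have hterm : ∀ s, ∀ a ∈ 𝓜.act s, π s a * 𝓜.advantage r h ρ s a ≤ 0 := fun s a ha => by
    by_cases hne : a = β s
    · rw [hne, advantage_self hh, mul_zero]
    · exact mul_nonpos_of_nonneg_of_nonpos (hπ.1.1 s a ha) (hneg s a ha hne).le
  have hvalue : ρ ≤ 𝓜.lpValue r π := calc
    ρ = 𝓜.lpValue r (𝓜.occupation β p) := by
      rw [lpValue_occupation, dotProduct_eq_add_dotProduct_advantage hp r h ρ]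
      simp [advantage_self hh, dotProduct]
    _ ≤ 𝓜.lpValue r π := hπ.2 _ (lpFeasible_occupation hp)
  have hsum : ∑ s, ∑ a ∈ 𝓜.act s, π s a * 𝓜.advantage r h ρ s a = 0 := by
    refine le_antisymm (Finset.sum_nonpos fun s _ => Finset.sum_nonpos (hterm s)) ?_
    linarith [hπ.1.lpValue_eq_add_sum_advantage r h ρ]
  have hstate := (Finset.sum_eq_zero_iff_of_nonpos fun s _ => Finset.sum_nonpos (hterm s)).1 hsum s
    (Finset.mem_univ s)
  have hzero := (Finset.sum_eq_zero_iff_of_nonpos (hterm s)).1 hstate a ha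
  exact (mul_eq_zero.1 hzero).resolve_right (hneg s a ha hne).ne

lemma LPFeasible.isStationary (hπ : 𝓜.LPFeasible π)
    (hsupp : ∀ s, ∀ a ∈ 𝓜.act s, a ≠ β s → π s a = 0) :
    IsStationary (𝓜.chain β) fun s => π s (β s) := by
  have hsingle : ∀ s (g : A → ℝ), ∑ a ∈ 𝓜.act s, π s a * g a = π s (β s) * g (β s) := fun s g =>
    Finset.sum_eq_single_of_mem _ (β s).2 fun a ha hne => by rw [hsupp s a ha hne, zero_mul]
  have hmarginal : ∀ s, ∑ a ∈ 𝓜.act s, π s a = π s (β s) := fun s => by simpa using hsingle s 1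
  refine ⟨fun s => hπ.1 s _ (β s).2, by simpa only [hmarginal] using hπ.2.1, ?_⟩
  ext s'
  rw [← hmarginal, hπ.2.2]
  exact (Finset.sum_congr rfl fun s _ => hsingle s fun a => 𝓜.trans s a s').symm

theorem IsLPPolicy.eq_of_unique (hβ : 𝓜.IsLPPolicy r β) (hirr : (𝓜.chain β₀).IsIrreducible)
    (hγ : contraction (𝓜.chain β₀) < 1)
    (hopt : ∀ β, β ≠ β₀ → 𝓜.avgReward r β < 𝓜.avgReward r β₀) : β = β₀ := by
  funext s
  have : Nonempty S := ⟨s⟩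
  obtain ⟨π, hπ, hargmax⟩ := hβ
  have hstat := isStationary_stationaryDist β₀
  obtain ⟨h, hh⟩ := hstat.exists_solvesPoisson (chain_sum β₀) hγ fun s => r (β₀ s)
  have hsupp : ∀ s, ∀ a ∈ 𝓜.act s, a ≠ β₀ s → π s a = 0 := fun _ _ ha hne =>
    hπ.eq_zero_of_advantage_neg hstat hh (fun _ _ => advantage_neg_of_unique hh hopt) ha hne
  by_contra hne
  have hzero : π s (β s) = 0 := hsupp s (β s) (β s).2 fun h => hne (Subtype.ext h)
  have hpos : 0 < π s (β₀ s) := (hπ.1.isStationary hsupp).pos hirr s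
  linarith [hargmax s (β₀ s) (β₀ s).2]

end MDP

/-! ### Exploration slots -/

section Exploration

variable {M : ℕ} {w : ℝ} {R : Set ℕ}

lemma one_le_ceil_mul_log (hw : 0 < w) {t : ℕ} (ht : 2 ≤ t) : 1 ≤ ⌈w * Real.log t⌉ :=
  Int.one_le_ceil_iff.2 (mul_pos hw (Real.log_pos (by exact_mod_cast ht)))

lemma ceil_mul_log_mono (hw : 0 ≤ w) {s t : ℕ} (hs : 1 ≤ s) (hst : s ≤ t) :
    ⌈w * Real.log s⌉ ≤ ⌈w * Real.log t⌉ := by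
  have : (0 : ℝ) < s := by exact_mod_cast hs
  gcongr

lemma ncard_inter_Icc_eq_count [DecidablePred (· ∈ R)] (h0 : 0 ∉ R) (t : ℕ) :
    (R ∩ Set.Icc 1 (t - 1)).ncard = Nat.count (· ∈ R) t := by
  rw [Nat.count_eq_card_filter_range, ← Set.ncard_coe_finset]
  congr 1
  ext i
  have : i ∈ R → i ≠ 0 := fun hi h => h0 (h ▸ hi)
  simp only [Set.mem_inter_iff, Set.mem_Icc, Finset.coe_filter, Finset.mem_range,
    Set.mem_ofPred_eq]
  grind

namespace IsExplorationSequence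

lemma mem_iff [DecidablePred (· ∈ R)] (hR : IsExplorationSequence M w R) {t : ℕ} (ht : 1 < t) :
    t ∈ R ↔ (Nat.count (· ∈ R) t : ℤ) < M * ⌈w * Real.log t⌉ := by
  rw [hR.2 t ht, ncard_inter_Icc_eq_count hR.1]

lemma one_mem_of_two_notMem [NeZero M] (hR : IsExplorationSequence M w R) (hw : 0 < w)
    (h2 : 2 ∉ R) : 1 ∈ R := by
  classical
  by_contra h1
  have hcount : Nat.count (· ∈ R) 2 = 0 := by simp [Nat.count_succ, hR.1, h1]
  refine h2 ((hR.mem_iff one_lt_two).2 ?_)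
  rw [hcount]
  exact mul_pos (by exact_mod_cast Nat.pos_of_neZero M) (one_le_ceil_mul_log hw le_rfl)

lemma card_filter_Icc_le [DecidablePred (· ∈ R)] (hR : IsExplorationSequence M w R)
    (hw : 0 ≤ w) {T : ℕ} (hT : 1 ≤ T) :
    ((Finset.Icc 2 T).filter (· ∈ R)).card ≤ M * ⌈w * Real.log T⌉ := by
  induction T, hT using Nat.le_induction with
  | base => simp
  | succ t ht ih =>
    rw [← Finset.insert_Icc_right_eq_Icc_add_one (by omega), Finset.filter_insert]
    split_ifs with hmem
    · have hcount : ((Finset.Icc 2 t).filter (· ∈ R)).card ≤ Nat.count (· ∈ R) (t + 1) := by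
        rw [Nat.count_eq_card_filter_range]
        refine Finset.card_le_card (Finset.filter_subset_filter _ fun i hi => ?_)
        simp only [Finset.mem_Icc, Finset.mem_range] at hi ⊢
        omega
      have hlt := (hR.mem_iff (by omega)).1 hmem
      have hinsert := Finset.card_insert_le (t + 1) ((Finset.Icc 2 t).filter (· ∈ R))
      omega
    · exact ih.trans (mul_le_mul_of_nonneg_left (ceil_mul_log_mono hw ht t.le_succ) (by positivity))

lemma lt_ceil_of_count_eq [NeZero M] [DecidablePred (· ∈ R)] (hR : IsExplorationSequence M w R)
    (hw : 0 < w) {s q : ℕ} (hs : s ∈ R) (hq : Nat.count (· ∈ R) s = M * q) {t : ℕ} (hst : s < t) :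
    q < ⌈w * Real.log t⌉ := by
  have hs0 : s ≠ 0 := fun h => hR.1 (h ▸ hs)
  rcases Nat.lt_or_ge 1 s with h1 | h1
  · have hlt := (hR.mem_iff h1).1 hs
    rw [hq, Nat.cast_mul] at hlt
    exact (lt_of_mul_lt_mul_left hlt (by positivity)).trans_le
      (ceil_mul_log_mono hw.le h1.le hst.le)
  · obtain rfl : s = 1 := by omega
    rw [Nat.count_one, if_neg hR.1, eq_comm, mul_eq_zero, or_iff_right (NeZero.ne M)] at hq
    rw [hq]
    exact one_le_ceil_mul_log hw hst

/-- Exploration slots come in runs of `M`: during a run, `⌈w ln t⌉` does not decrease. -/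
lemma Ico_subset [NeZero M] [DecidablePred (· ∈ R)] (hR : IsExplorationSequence M w R)
    (hw : 0 < w) {s q : ℕ} (hs : s ∈ R) (hq : Nat.count (· ∈ R) s = M * q) :
    Set.Ico s (s + M) ⊆ R := by
  suffices hrun : ∀ i < M, s + i ∈ R ∧ Nat.count (· ∈ R) (s + i) = M * q + i by
    intro t ht
    obtain ⟨i, rfl⟩ := Nat.exists_eq_add_of_le ht.1
    exact (hrun i (by simpa using ht.2)).1
  intro i hi
  induction i with
  | zero => exact ⟨hs, hq⟩
  | succ i ih =>
    obtain ⟨hmem, hcount⟩ := ih (by omega)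
    have hcount' : Nat.count (· ∈ R) (s + (i + 1)) = M * q + (i + 1) := by
      rw [← add_assoc, Nat.count_succ, hcount, if_pos hmem, add_assoc]
    refine ⟨(hR.mem_iff ?_).2 ?_, hcount'⟩
    · have : s ≠ 0 := fun h => hR.1 (h ▸ hs)
      omega
    · have hceil : (q : ℤ) + 1 ≤ ⌈w * Real.log (s + (i + 1) : ℕ)⌉ :=
        hR.lt_ceil_of_count_eq hw hs hq (by omega)
      calc ((Nat.count (· ∈ R) (s + (i + 1)) : ℕ) : ℤ) < M * (q + 1) := by
            rw [hcount']
            push_cast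
            linarith [(Nat.cast_lt (α := ℤ)).2 hi]
        _ ≤ _ := mul_le_mul_of_nonneg_left hceil (by positivity)

end IsExplorationSequence

variable [NeZero M]

lemma exists_roundRobin_eq (s : ℕ) (j : Fin M) :
    ∃ i ∈ Set.Icc (s + 1) (s + M), roundRobin M i = j := by
  have hM : 0 < M := Nat.pos_of_neZero M
  have hmod := Nat.mod_lt (j + (M - s % M)) hM
  refine ⟨s + (j + (M - s % M)) % M + 1, ⟨by omega, by omega⟩, Fin.ext ?_⟩
  have hs := Nat.mod_lt s hM
  calc (s + (j + (M - s % M)) % M) % M = (s % M + (j + (M - s % M))) % M := by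
        rw [Nat.add_mod_mod, Nat.mod_add_mod]
    _ = (j + M) % M := by congr 1; omega
    _ = j := by rw [Nat.add_mod_right, Nat.mod_eq_of_lt j.2]

lemma exploreCount_mono (R : Set ℕ) (j : Fin M) : Monotone fun n => exploreCount R n j :=
  monotone_nat_of_le_succ fun n => by
    rw [exploreCount]
    split_ifs <;> omega

lemma exploreCount_add_one_le {s : ℕ} (hs : Set.Icc (s + 1) (s + M) ⊆ R) (j : Fin M) :
    exploreCount R s j + 1 ≤ exploreCount R (s + M) j := by
  obtain ⟨i, hi, hij⟩ := exists_roundRobin_eq s j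
  obtain ⟨i, rfl⟩ : ∃ k, i = k + 1 := ⟨i - 1, by have := hi.1; omega⟩
  calc exploreCount R s j + 1 ≤ exploreCount R i j + 1 :=
        Nat.add_le_add_right (exploreCount_mono R j (Nat.le_of_succ_le_succ hi.1)) 1
    _ = exploreCount R (i + 1) j := by rw [exploreCount, if_pos ⟨hs hi, hij⟩]
    _ ≤ exploreCount R (s + M) j := exploreCount_mono R j hi.2

namespace IsExplorationSequence

lemma le_exploreCount_of_mul_le_count [DecidablePred (· ∈ R)] (hR : IsExplorationSequence M w R)
    (hw : 0 < w) (j : Fin M) {q n : ℕ} (hq : M * q ≤ Nat.count (· ∈ R) (n + 1)) :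
    q ≤ exploreCount R n j := by
  induction q generalizing n with
  | zero => exact Nat.zero_le _
  | succ q ih =>
    have hM : 0 < M := Nat.pos_of_neZero M
    rw [Nat.mul_succ] at hq
    have hlt : M * q < Nat.count (· ∈ R) (n + 1) := by omega
    -- `s + 1` is the slot of the exploration number `M q`, counted from zero.
    obtain ⟨s, hs, hcount⟩ : ∃ s, s + 1 ∈ R ∧ Nat.count (· ∈ R) (s + 1) = M * q := by
      have hcard : ∀ hf : (Set.ofPred (· ∈ R)).Finite, M * q < hf.toFinset.card := fun hf =>
        hlt.trans_le (Nat.count_le_card hf _)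
      have hmem : Nat.nth (· ∈ R) (M * q) ∈ R := Nat.nth_mem _ hcard
      obtain ⟨s, hs⟩ := Nat.exists_eq_succ_of_ne_zero fun h => hR.1 (h ▸ hmem)
      rw [hs] at hmem
      exact ⟨s, hmem, by rw [← Nat.succ_eq_add_one, ← hs, Nat.count_nth hcard]⟩
    have hrun : Set.Icc (s + 1) (s + M) ⊆ R := fun i hi =>
      hR.Ico_subset hw hs hcount ⟨hi.1, by have := hi.2; omega⟩
    have hend : s + M ≤ n := by
      by_contra! hn
      have hle : Nat.count (· ∈ R) (n + 1) ≤ M * q + (n - s) := by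
        calc Nat.count (· ∈ R) (n + 1) ≤ Nat.count (· ∈ R) (s + 1 + (n - s)) :=
              Nat.count_monotone _ (by omega)
          _ ≤ M * q + (n - s) := by
              rw [Nat.count_add, hcount]
              exact Nat.add_le_add_left (Nat.count_le _) _
      omega
    calc q + 1 ≤ exploreCount R s j + 1 := Nat.succ_le_succ (ih hcount.ge)
      _ ≤ exploreCount R (s + M) j := exploreCount_add_one_le hrun j
      _ ≤ exploreCount R n j := exploreCount_mono R j hend

theorem ceil_le_exploreCount (hR : IsExplorationSequence M w R) (hw : 0 < w) {n : ℕ} (hn : 2 ≤ n)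
    (hnR : n ∉ R) (j : Fin M) : ⌈w * Real.log n⌉ ≤ exploreCount R (n - 1) j := by
  classical
  have hcount : M * ⌈w * Real.log n⌉ ≤ Nat.count (· ∈ R) n :=
    not_lt.1 (mt (hR.mem_iff (by omega)).2 hnR)
  lift ⌈w * Real.log n⌉ to ℕ using zero_le_one.trans (one_le_ceil_mul_log hw hn) with q
  obtain ⟨n, rfl⟩ : ∃ k, n = k + 1 := ⟨n - 1, by omega⟩
  exact_mod_cast hR.le_exploreCount_of_mul_le_count hw j (by exact_mod_cast hcount)

end IsExplorationSequence

end Exploration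

/-! ### Concentration of the estimates -/

section Concentration

lemma rate_mem_Icc {A 𝒳 : Type*} [Finite A] {f : A → 𝒳 → ℝ}
    (hbelow : ∀ a, BddBelow (Set.range (f a))) (habove : ∀ a, BddAbove (Set.range (f a)))
    (a : A) (x : 𝒳) : f a x ∈ Set.Icc (⨅ x, f a x) ((⨅ x, f a x) + rateRange f) := by
  refine ⟨ciInf_le (hbelow a) x, ?_⟩
  have hrange : (⨆ x, f a x) - ⨅ x, f a x ≤ rateRange f :=
    le_ciSup (f := fun a => (⨆ x, f a x) - ⨅ x, f a x) (Set.finite_range _).bddAbove a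
  linarith [le_ciSup (habove a) x]

lemma measureReal_abs_ge_le_of_hasSubgaussianMGF {Ω : Type*} [MeasurableSpace Ω] {P : Measure Ω}
    [IsFiniteMeasure P] {Y : Ω → ℝ} {c : NNReal} (hY : HasSubgaussianMGF Y c P) {ε : ℝ}
    (hε : 0 ≤ ε) : P.real {ω | ε ≤ |Y ω|} ≤ 2 * Real.exp (-ε ^ 2 / (2 * c)) := by
  calc P.real {ω | ε ≤ |Y ω|} ≤ P.real ({ω | ε ≤ Y ω} ∪ {ω | ε ≤ (-Y) ω}) :=
        measureReal_mono fun ω (hω : ε ≤ |Y ω|) => le_abs.1 hω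
    _ ≤ P.real {ω | ε ≤ Y ω} + P.real {ω | ε ≤ (-Y) ω} := measureReal_union_le _ _
    _ ≤ 2 * Real.exp (-ε ^ 2 / (2 * c)) := by
        rw [two_mul]
        exact add_le_add (hY.measure_ge_le hε) (hY.neg.measure_ge_le hε)

namespace IsControlledSystem

variable {S A 𝒳 Ω : Type*} [Fintype S] [MeasurableSpace 𝒳] {mΩ : MeasurableSpace Ω}
  {Pr : Measure Ω} {M : ℕ} {𝓜 : MDP S A} {f : A → 𝒳 → ℝ} {ν : Fin M → Measure 𝒳} {R : Set ℕ}
  {ℱ : Filtration ℕ mΩ} {X : ℕ → Ω → Fin M → 𝒳} {st : ℕ → Ω → S} {ac : ℕ → Ω → A}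
  {ch : ℕ → Ω → Fin M}

lemma measurable_gain (hsys : IsControlledSystem 𝓜 ν Pr ℱ X st ac ch) {n : ℕ} (hn : 1 ≤ n)
    (j : Fin M) : Measurable fun ω => X n ω j :=
  (measurable_pi_apply j).comp ((hsys.gain_observed n hn).mono (ℱ.le _) le_rfl)

lemma integral_rate (hsys : IsControlledSystem 𝓜 ν Pr ℱ X st ac ch) {a : A}
    (hfa : Measurable (f a)) {n : ℕ} (hn : 1 ≤ n) (j : Fin M) :
    ∫ ω, f a (X n ω j) ∂Pr = meanRate f ν j a := by
  rw [meanRate, ← hsys.gain_law n hn j,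
    integral_map (hsys.measurable_gain hn j).aemeasurable hfa.aestronglyMeasurable]

lemma indepFun_gain (hsys : IsControlledSystem 𝓜 ν Pr ℱ X st ac ch) {n : ℕ} (hn : 1 ≤ n)
    (j : Fin M) {Y : Ω → ℝ} (hY : Measurable[ℱ n] Y) : Y ⟂ᵢ[Pr] fun ω => X n ω j := by
  have hX : X n ⟂ᵢ[Pr] Y := (IndepFun_iff_Indep ..).2
    (indep_of_indep_of_le_right (hsys.gain_indep n hn) hY.comap_le)
  exact hX.symm.comp measurable_id (measurable_pi_apply j)

lemma integrable_gainLaw [IsProbabilityMeasure Pr]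
    (hsys : IsControlledSystem 𝓜 ν Pr ℱ X st ac ch) {a : A} (hfa : Measurable (f a))
    (hbelow : BddBelow (Set.range (f a))) (habove : BddAbove (Set.range (f a))) (j : Fin M) :
    Integrable (f a) (ν j) := by
  have : IsProbabilityMeasure (ν j) := hsys.gain_law 1 le_rfl j ▸
    Measure.isProbabilityMeasure_map (hsys.measurable_gain le_rfl j).aemeasurable
  exact Integrable.of_mem_Icc (⨅ x, f a x) (⨆ x, f a x) hfa.aemeasurable
    (ae_of_all _ fun x => ⟨ciInf_le hbelow x, le_ciSup habove x⟩)

lemma hasSubgaussianMGF_rate [IsProbabilityMeasure Pr] [Finite A]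
    (hsys : IsControlledSystem 𝓜 ν Pr ℱ X st ac ch) {a : A} (hfa : Measurable (f a))
    (hbelow : ∀ a, BddBelow (Set.range (f a))) (habove : ∀ a, BddAbove (Set.range (f a)))
    {n : ℕ} (hn : 1 ≤ n) (j : Fin M) :
    HasSubgaussianMGF (fun ω => f a (X n ω j) - meanRate f ν j a)
      ((‖rateRange f‖₊ / 2) ^ 2) Pr := by
  have h := hasSubgaussianMGF_of_mem_Icc (μ := Pr) (X := fun ω => f a (X n ω j))
    (hfa.comp (hsys.measurable_gain hn j)).aemeasurable
    (ae_of_all _ fun ω => rate_mem_Icc hbelow habove a _)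
  rwa [add_sub_cancel_left, hsys.integral_rate hfa hn] at h

variable [NeZero M]

lemma measurable_estimate (hsys : IsControlledSystem 𝓜 ν Pr ℱ X st ac ch) {a : A}
    (hfa : Measurable (f a)) (n : ℕ) (j : Fin M) :
    Measurable[ℱ (n + 1)] fun ω => estimate f R (fun k => X k ω) n j a := by
  induction n with
  | zero => exact measurable_const
  | succ n ih =>
    have hold := ih.mono (ℱ.mono (Nat.le_succ (n + 1))) le_rfl
    have hnew : Measurable[ℱ (n + 1 + 1)] fun ω => f a (X (n + 1) ω j) :=
      hfa.comp ((measurable_pi_apply j).comp (hsys.gain_observed (n + 1) (by omega)))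
    simp only [estimate]
    split_ifs
    · exact ((hold.const_mul _).add hnew).div_const _
    · exact hold

variable [IsProbabilityMeasure Pr] [Finite A]

/-- By `gain_indep`, each new centred rate is independent of the sum of the earlier ones. -/
lemma hasSubgaussianMGF_estimate (hsys : IsControlledSystem 𝓜 ν Pr ℱ X st ac ch) {a : A}
    (hfa : Measurable (f a)) (hbelow : ∀ a, BddBelow (Set.range (f a)))
    (habove : ∀ a, BddAbove (Set.range (f a))) (n : ℕ) (j : Fin M) :
    HasSubgaussianMGF (fun ω => (exploreCount R n j : ℝ) *
      (estimate f R (fun k => X k ω) n j a - meanRate f ν j a))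
      (exploreCount R n j * (‖rateRange f‖₊ / 2) ^ 2) Pr := by
  induction n with
  | zero => simp [exploreCount, HasSubgaussianMGF.fun_zero]
  | succ n ih =>
    by_cases hn : n + 1 ∈ R ∧ roundRobin M (n + 1) = j
    · have hindep : (fun ω => (exploreCount R n j : ℝ) *
          (estimate f R (fun k => X k ω) n j a - meanRate f ν j a)) ⟂ᵢ[Pr]
          fun ω => f a (X (n + 1) ω j) - meanRate f ν j a :=
        (hsys.indepFun_gain n.succ_pos j
          (((hsys.measurable_estimate hfa n j).sub_const _).const_mul _)).comp
          measurable_id (hfa.sub_const _)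
      convert ih.add_of_indepFun
        (hsys.hasSubgaussianMGF_rate hfa hbelow habove n.succ_pos j) hindep using 1
      · ext ω
        simp only [exploreCount, estimate, if_pos hn]
        push_cast
        field_simp
        ring
      · simp only [exploreCount, if_pos hn]
        push_cast
        ring
    · simpa only [exploreCount, estimate, if_neg hn] using ih

theorem measureReal_abs_estimate_sub_ge_le (hsys : IsControlledSystem 𝓜 ν Pr ℱ X st ac ch) {a : A}
    (hfa : Measurable (f a)) (hbelow : ∀ a, BddBelow (Set.range (f a)))
    (habove : ∀ a, BddAbove (Set.range (f a))) (n : ℕ) (j : Fin M) {ε : ℝ} (hε : 0 ≤ ε) :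
    Pr.real {ω | ε ≤ |estimate f R (fun k => X k ω) n j a - meanRate f ν j a|} ≤
      2 * Real.exp (-(exploreCount R n j * (2 * ε ^ 2 / rateRange f ^ 2))) := by
  rcases (exploreCount R n j).eq_zero_or_pos with h0 | hpos
  · refine measureReal_le_one.trans ?_
    norm_num [h0]
  have hN : (0 : ℝ) < exploreCount R n j := by exact_mod_cast hpos
  have htail := measureReal_abs_ge_le_of_hasSubgaussianMGF
    (hsys.hasSubgaussianMGF_estimate (R := R) hfa hbelow habove n j) (mul_nonneg hN.le hε)
  have hexp : -(exploreCount R n j * ε) ^ 2 /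
      (2 * ((exploreCount R n j * (‖rateRange f‖₊ / 2) ^ 2 : NNReal) : ℝ)) =
      -(exploreCount R n j * (2 * ε ^ 2 / rateRange f ^ 2)) := by
    push_cast
    rw [div_pow, Real.norm_eq_abs, sq_abs]
    rcases eq_or_ne (rateRange f) 0 with h0 | h0
    · simp [h0]
    · field_simp
  simpa only [abs_mul, abs_of_pos hN, mul_le_mul_iff_right₀ hN, hexp] using htail

lemma measureReal_abs_estimate_sub_ge_le_rpow (hsys : IsControlledSystem 𝓜 ν Pr ℱ X st ac ch)
    {a : A} (hfa : Measurable (f a)) (hbelow : ∀ a, BddBelow (Set.range (f a)))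
    (habove : ∀ a, BddAbove (Set.range (f a))) {w : ℝ} (hw : 0 < w)
    (hR : IsExplorationSequence M w R) {n : ℕ} (hn : 2 ≤ n) (hnR : n ∉ R) (j : Fin M) {d : ℝ}
    (hd : 0 ≤ d) :
    Pr.real {ω | d / 2 ≤ |estimate f R (fun k => X k ω) (n - 1) j a - meanRate f ν j a|} ≤
      2 * (n : ℝ) ^ (-(w * d ^ 2 / (2 * rateRange f ^ 2))) := by
  have hcount : w * Real.log n ≤ exploreCount R (n - 1) j :=
    Int.ceil_le.1 (hR.ceil_le_exploreCount hw hn hnR j)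
  have hn0 : (0 : ℝ) < n := by exact_mod_cast (by omega : 0 < n)
  calc _ ≤ 2 * Real.exp (-(exploreCount R (n - 1) j * (2 * (d / 2) ^ 2 / rateRange f ^ 2))) :=
        hsys.measureReal_abs_estimate_sub_ge_le hfa hbelow habove _ _ (by positivity)
    _ ≤ 2 * Real.exp (-(w * Real.log n * (2 * (d / 2) ^ 2 / rateRange f ^ 2))) := by gcongr
    _ = 2 * (n : ℝ) ^ (-(w * d ^ 2 / (2 * rateRange f ^ 2))) := by
        rw [Real.rpow_def_of_pos hn0]
        ring_nf

end IsControlledSystem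

theorem IsControlledSystem.measureReal_exists_abs_estimate_sub_ge_le {S A 𝒳 Ω : Type*} [Fintype S]
    [Fintype A] [MeasurableSpace 𝒳] {mΩ : MeasurableSpace Ω} {Pr : Measure Ω}
    [IsProbabilityMeasure Pr] {M : ℕ} [NeZero M] {𝓜 : MDP S A} {f : A → 𝒳 → ℝ}
    {ν : Fin M → Measure 𝒳} {R : Set ℕ} {ℱ : Filtration ℕ mΩ} {X : ℕ → Ω → Fin M → 𝒳}
    {st : ℕ → Ω → S} {ac : ℕ → Ω → A} {ch : ℕ → Ω → Fin M}
    (hsys : IsControlledSystem 𝓜 ν Pr ℱ X st ac ch) (hf : ∀ a, Measurable (f a))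
    (hbelow : ∀ a, BddBelow (Set.range (f a))) (habove : ∀ a, BddAbove (Set.range (f a))) {w : ℝ}
    (hw : 0 < w) (hR : IsExplorationSequence M w R) {n : ℕ} (hn : 2 ≤ n) (hnR : n ∉ R) {d : ℝ}
    (hd : 0 ≤ d) :
    Pr.real {ω | ∃ a j, d / 2 ≤
        |estimate f R (fun k => X k ω) (n - 1) j a - meanRate f ν j a|} ≤
      2 * Fintype.card A * M * (n : ℝ) ^ (-(w * d ^ 2 / (2 * rateRange f ^ 2))) := by
  calc _ = Pr.real (⋃ p : A × Fin M, {ω | d / 2 ≤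
          |estimate f R (fun k => X k ω) (n - 1) p.2 p.1 - meanRate f ν p.2 p.1|}) := by
        congr 1
        ext ω
        simp only [Set.mem_ofPred_eq, Set.mem_iUnion, Prod.exists]
    _ ≤ ∑ p : A × Fin M, 2 * (n : ℝ) ^ (-(w * d ^ 2 / (2 * rateRange f ^ 2))) :=
        (measureReal_iUnion_fintype_le _).trans (Finset.sum_le_sum fun p _ =>
          hsys.measureReal_abs_estimate_sub_ge_le_rpow (hf p.1) hbelow habove hw hR hn hnR p.2 hd)
    _ = _ := by
        rw [Finset.sum_const, Finset.card_univ, Fintype.card_prod, Fintype.card_fin, nsmul_eq_mul]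
        push_cast
        ring

end Concentration

/-! ### Correctness of the learned policies -/

section Policies

variable {S A : Type*} [Fintype S] {M : ℕ} [NeZero M] {𝓜 : MDP S A} {m : Fin M → A → ℝ} {d : ℝ}

lemma le_bestRate (m : Fin M → A → ℝ) (j : Fin M) (a : A) : m j a ≤ bestRate m a :=
  (Finite.exists_max fun j => m j a).choose_spec j

lemma le_bestRate_sub_of_le_delta3 (hd : (d : EReal) ≤ delta3 m) {a : A} {j : Fin M}
    (hj : m j a < bestRate m a) : d ≤ bestRate m a - m j a :=
  EReal.coe_le_coe_iff.1 (hd.trans (iInf_le_of_le a (iInf_le_of_le j (iInf_le _ hj))))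

lemma le_optRate_sub_of_le_delta4 [Finite A] (hd : (d : EReal) ≤ 𝓜.delta4 m) {β : 𝓜.Policy}
    (hβ : β ≠ 𝓜.bestPolicy m) : d ≤ 𝓜.optRate m - 𝓜.avgRate m β (bestChannel m) :=
  EReal.coe_le_coe_iff.1 (hd.trans (iInf_le_of_le β (iInf_le _ hβ)))

lemma eq_bestRate_of_abs_sub_lt (hd : (d : EReal) ≤ delta3 m) {θ : Fin M → A → ℝ} {a : A}
    (hθ : ∀ j, |θ j a - m j a| < d / 2) {i : Fin M} (hi : ∀ j, θ j a ≤ θ i a) :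
    m i a = bestRate m a := by
  by_contra hne
  have hgap : d ≤ m (bestChannel m a) a - m i a :=
    le_bestRate_sub_of_le_delta3 hd ((le_bestRate m i a).lt_of_ne hne)
  linarith [(abs_lt.1 (hθ i)).2, (abs_lt.1 (hθ (bestChannel m a))).1, hi (bestChannel m a)]

lemma eq_bestPolicy_of_abs_sub_lt [Finite A] [Nonempty S]
    (hirr : (𝓜.chain (𝓜.bestPolicy m)).IsIrreducible) (hγ : 𝓜.gamma m < 1)
    (hd : (d : EReal) ≤ 𝓜.delta4 m) {r : A → ℝ} (hr : ∀ a, |r a - bestRate m a| < d / 2)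
    {β : 𝓜.Policy} (hβ : 𝓜.IsLPPolicy r β) : β = 𝓜.bestPolicy m := by
  have hclose : ∀ β, |𝓜.avgReward r β - 𝓜.avgRate m β (bestChannel m)| < d / 2 := fun β =>
    (MDP.isStationary_stationaryDist β).abs_dotProduct_sub_dotProduct_lt fun s => hr (β s)
  refine hβ.eq_of_unique hirr hγ fun β' hβ' => ?_
  have hgap : d ≤ 𝓜.avgRate m (𝓜.bestPolicy m) (bestChannel m) - 𝓜.avgRate m β' (bestChannel m) :=
    le_optRate_sub_of_le_delta4 hd hβ'
  linarith [(abs_lt.1 (hclose β')).2, (abs_lt.1 (hclose (𝓜.bestPolicy m))).1]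

namespace IsMCLPSM

variable {𝒳 Ω : Type*} {mΩ : MeasurableSpace Ω} {f : A → 𝒳 → ℝ} {R : Set ℕ} {ℱ : Filtration ℕ mΩ}
  {X : ℕ → Ω → Fin M → 𝒳} {st : ℕ → Ω → S} {ac : ℕ → Ω → A} {ch : ℕ → Ω → Fin M}
  {β : ℕ → Ω → 𝓜.Policy} {φ : ℕ → Ω → A → Fin M} {w : ℝ}

/-- The estimates change only in exploration slots, so the policies kept since the last one are
still those that the current estimates produce. -/
lemma policies_of_current_estimates (halg : IsMCLPSM 𝓜 f R ℱ X st ac ch β φ) (hw : 0 < w)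
    (hR : IsExplorationSequence M w R) {n : ℕ} (hn : 2 ≤ n) (hnR : n ∉ R) (ω : Ω) :
    (∀ a j, estimate f R (fun k => X k ω) (n - 1) j a
      ≤ estimate f R (fun k => X k ω) (n - 1) (φ n ω a) a) ∧
    𝓜.IsLPPolicy (fun a => estimate f R (fun k => X k ω) (n - 1) (φ n ω a) a) (β n ω) := by
  have hupdate : ∀ n, 2 ≤ n → n ∉ R → n - 1 ∈ R → _ := fun n hn hnR hprev =>
    And.intro (halg.mapping_update n hn hnR hprev ω) (halg.policy_update n hn hnR hprev ω)
  induction n, hn using Nat.le_induction with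
  | base => exact hupdate 2 le_rfl hnR (hR.one_mem_of_two_notMem hw hnR)
  | succ n hn ih =>
    by_cases hprev : n ∈ R
    · exact hupdate (n + 1) (by omega) hnR hprev
    · obtain ⟨hβ, hφ⟩ := halg.keep (n + 1) (by omega) hnR hprev ω
      obtain ⟨k, rfl⟩ : ∃ k, n = k + 1 := ⟨n - 1, by omega⟩
      have hest : ∀ j a, estimate f R (fun k => X k ω) (k + 1) j a
          = estimate f R (fun k => X k ω) k j a := fun j a => by
        rw [estimate, if_neg fun hk => hprev hk.1]
      simp only [Nat.add_sub_cancel] at hβ hφ ih ⊢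
      simpa only [hβ, hφ, hest] using ih hprev

theorem optimal_decision_of_abs_sub_lt [Finite A] (halg : IsMCLPSM 𝓜 f R ℱ X st ac ch β φ)
    (hirr : (𝓜.chain (𝓜.bestPolicy m)).IsIrreducible) (hγ : 𝓜.gamma m < 1) (hw : 0 < w)
    (hR : IsExplorationSequence M w R) (hd : (d : EReal) ≤ min (delta3 m) (𝓜.delta4 m))
    {n : ℕ} (hn : 2 ≤ n) (hnR : n ∉ R) {ω : Ω}
    (hθ : ∀ a j, |estimate f R (fun k => X k ω) (n - 1) j a - m j a| < d / 2) :
    ac n ω = 𝓜.bestPolicy m (st n ω) ∧ m (ch n ω) (ac n ω) = bestRate m (ac n ω) := by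
  have : Nonempty S := ⟨st n ω⟩
  obtain ⟨hφ, hβ⟩ := halg.policies_of_current_estimates hw hR hn hnR ω
  obtain ⟨hac, hch⟩ := halg.exploit n (by omega) hnR ω
  have hbest : ∀ a, m (φ n ω a) a = bestRate m a := fun a =>
    eq_bestRate_of_abs_sub_lt (hd.trans (min_le_left _ _)) (hθ a) (hφ a)
  have hβ_eq : β n ω = 𝓜.bestPolicy m :=
    eq_bestPolicy_of_abs_sub_lt hirr hγ (hd.trans (min_le_right _ _))
      (fun a => by simpa only [hbest] using hθ a (φ n ω a)) hβ
  exact ⟨by rw [hac, hβ_eq], by rw [hch, hbest]⟩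

end IsMCLPSM

end Policies

/-! ### Expectations in a controlled system -/

section Expectation

section FiniteValued

variable {Ω α : Type*} {m₁ m₂ mΩ : MeasurableSpace Ω} {P : Measure Ω} {Y : Ω → α} {Z : α → Ω → ℝ}

lemma apply_eq_sum_indicator [Fintype α] (Y : Ω → α) (Z : α → Ω → ℝ) :
    (fun ω => Z (Y ω) ω) = fun ω => ∑ a, {ω | Y ω = a}.indicator (Z a) ω := by
  classical
  ext ω
  simp [Set.indicator_apply]

lemma integrable_apply [Finite α] (hY : ∀ a, MeasurableSet {ω | Y ω = a})
    (hZ : ∀ a, Integrable (Z a) P) : Integrable (fun ω => Z (Y ω) ω) P := by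
  have := Fintype.ofFinite α
  rw [apply_eq_sum_indicator]
  exact integrable_finsetSum _ fun a _ => (hZ a).indicator (hY a)

lemma integral_apply_eq_sum_setIntegral [Fintype α] (hY : ∀ a, MeasurableSet {ω | Y ω = a})
    (hZ : ∀ a, Integrable (Z a) P) :
    ∫ ω, Z (Y ω) ω ∂P = ∑ a, ∫ ω in {ω | Y ω = a}, Z a ω ∂P := by
  rw [apply_eq_sum_indicator, integral_finsetSum _ fun a _ => (hZ a).indicator (hY a)]
  exact Finset.sum_congr rfl fun a _ => integral_indicator (hY a)

lemma integral_apply_of_indep [Finite α] [IsFiniteMeasure P] (hm₁ : m₁ ≤ mΩ) (hm₂ : m₂ ≤ mΩ)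
    (hindep : Indep m₁ m₂ P) (hY : ∀ a, MeasurableSet[m₂] {ω | Y ω = a})
    (hZ : ∀ a, Measurable[m₁] (Z a)) (hZ_int : ∀ a, Integrable (Z a) P) :
    ∫ ω, Z (Y ω) ω ∂P = ∫ ω, P[Z (Y ω)] ∂P := by
  have := Fintype.ofFinite α
  rw [integral_apply_eq_sum_setIntegral (fun a => hm₂ _ (hY a)) hZ_int,
    integral_apply_eq_sum_setIntegral (Z := fun a _ => P[Z a]) (fun a => hm₂ _ (hY a))
      fun a => integrable_const _]
  refine Finset.sum_congr rfl fun a _ => ?_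
  rw [← setIntegral_condExp hm₂ (hZ_int a) (hY a)]
  exact integral_congr_ae (ae_restrict_of_ae
    (condExp_indep_eq hm₁ hm₂ (hZ a).stronglyMeasurable hindep))

end FiniteValued

namespace IsControlledSystem

variable {S A 𝒳 Ω : Type*} [Fintype S] [MeasurableSpace 𝒳] {mΩ : MeasurableSpace Ω}
  {Pr : Measure Ω} {M : ℕ} {𝓜 : MDP S A} {f : A → 𝒳 → ℝ}
  {ν : Fin M → Measure 𝒳} {ℱ : Filtration ℕ mΩ} {X : ℕ → Ω → Fin M → 𝒳} {st : ℕ → Ω → S}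
  {ac : ℕ → Ω → A} {ch : ℕ → Ω → Fin M}

lemma integrable_rate (hsys : IsControlledSystem 𝓜 ν Pr ℱ X st ac ch)
    (hf : ∀ j a, Integrable (f a) (ν j)) {n : ℕ} (hn : 1 ≤ n) (j : Fin M) (a : A) :
    Integrable (fun ω => f a (X n ω j)) Pr := by
  refine Integrable.comp_measurable ?_ (hsys.measurable_gain hn j)
  rw [hsys.gain_law n hn j]
  exact hf j a

lemma measurableSet_action_channel_eq (hsys : IsControlledSystem 𝓜 ν Pr ℱ X st ac ch) {n : ℕ}
    (hn : 1 ≤ n) (p : A × Fin M) : MeasurableSet[ℱ n] {ω | (ac n ω, ch n ω) = p} := by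
  simp only [Prod.ext_iff]
  exact (hsys.action_adapted n hn _).inter (hsys.channel_adapted n hn _)

lemma measurableSet_decision_eq (hsys : IsControlledSystem 𝓜 ν Pr ℱ X st ac ch) {n : ℕ}
    (hn : 1 ≤ n) (p : S × A × Fin M) : MeasurableSet[ℱ n] {ω | (st n ω, ac n ω, ch n ω) = p} := by
  simp only [Prod.ext_iff (x := (_, _, _))]
  exact (hsys.state_adapted n hn _).inter (hsys.measurableSet_action_channel_eq hn _)

variable [Finite A]

lemma integrable_reward (hsys : IsControlledSystem 𝓜 ν Pr ℱ X st ac ch)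
    (hf : ∀ j a, Integrable (f a) (ν j)) {n : ℕ} (hn : 1 ≤ n) :
    Integrable (fun ω => f (ac n ω) (X n ω (ch n ω))) Pr :=
  integrable_apply (Z := fun (p : A × Fin M) ω => f p.1 (X n ω p.2))
    (fun p => ℱ.le n _ (hsys.measurableSet_action_channel_eq hn p))
    fun p => hsys.integrable_rate hf hn p.2 p.1

variable [IsFiniteMeasure Pr]

lemma integrable_decision (hsys : IsControlledSystem 𝓜 ν Pr ℱ X st ac ch) {n : ℕ} (hn : 1 ≤ n)
    (g : S → A → Fin M → ℝ) : Integrable (fun ω => g (st n ω) (ac n ω) (ch n ω)) Pr :=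
  integrable_apply (Z := fun p _ => g p.1 p.2.1 p.2.2)
    (fun p => ℱ.le n _ (hsys.measurableSet_decision_eq hn p)) fun _ => integrable_const _

theorem integral_reward (hsys : IsControlledSystem 𝓜 ν Pr ℱ X st ac ch)
    (hf_meas : ∀ a, Measurable (f a)) (hf : ∀ j a, Integrable (f a) (ν j)) {n : ℕ} (hn : 1 ≤ n) :
    ∫ ω, f (ac n ω) (X n ω (ch n ω)) ∂Pr = ∫ ω, meanRate f ν (ch n ω) (ac n ω) ∂Pr := by
  have hX : Measurable (X n) := (hsys.gain_observed n hn).mono (ℱ.le _) le_rfl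
  have h := integral_apply_of_indep (Z := fun (p : A × Fin M) ω => f p.1 (X n ω p.2))
    hX.comap_le (ℱ.le n) (hsys.gain_indep n hn) (hsys.measurableSet_action_channel_eq hn)
    (fun p => (hf_meas p.1).comp ((measurable_pi_apply p.2).comp (comap_measurable (X n))))
    fun p => hsys.integrable_rate hf hn p.2 p.1
  simpa only [hsys.integral_rate (hf_meas _) hn] using h

theorem integral_next_state (hsys : IsControlledSystem 𝓜 ν Pr ℱ X st ac ch) {n : ℕ} (hn : 1 ≤ n)
    (h : S → ℝ) :
    ∫ ω, h (st (n + 1) ω) ∂Pr = ∫ ω, 𝓜.trans (st n ω) (ac n ω) ⬝ᵥ h ∂Pr := by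
  have hnext : ∀ s', MeasurableSet {ω | st (n + 1) ω = s'} := fun s' =>
    ℱ.le (n + 1) _ (hsys.state_adapted (n + 1) (by omega) s')
  have hprob : ∀ s', Pr.real {ω | st (n + 1) ω = s'} = ∫ ω, 𝓜.trans (st n ω) (ac n ω) s' ∂Pr :=
    fun s' => by
      rw [← integral_congr_ae (hsys.transition n hn s'), integral_condExp,
        integral_indicator_const _ (hnext s'), smul_eq_mul, mul_one]
  have htrans : ∀ s', Integrable (fun ω => 𝓜.trans (st n ω) (ac n ω) s') Pr := fun s' =>
    hsys.integrable_decision hn fun s a _ => 𝓜.trans s a s'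
  calc ∫ ω, h (st (n + 1) ω) ∂Pr = ∑ s', Pr.real {ω | st (n + 1) ω = s'} * h s' := by
        rw [integral_apply_eq_sum_setIntegral (Z := fun s' _ => h s') hnext
          fun _ => integrable_const _]
        simp only [setIntegral_const, smul_eq_mul]
    _ = ∑ s', ∫ ω, 𝓜.trans (st n ω) (ac n ω) s' * h s' ∂Pr := by
        simp only [hprob, integral_mul_const]
    _ = ∫ ω, 𝓜.trans (st n ω) (ac n ω) ⬝ᵥ h ∂Pr :=
        (integral_finsetSum _ fun s' _ => (htrans s').mul_const _).symm

end IsControlledSystem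

end Expectation

/-! ### The regret bound -/

section Regret

lemma summable_add_one_rpow_neg {x : ℝ} (hx : 1 < x) :
    Summable fun t : ℕ => ((t : ℝ) + 1) ^ (-x) := by
  simpa using (summable_nat_add_iff 1).2 (Real.summable_nat_rpow.2 (neg_lt_neg hx))

lemma sum_Icc_two_rpow_neg_le {x : ℝ} (hx : 1 < x) {T : ℕ} (hT : 1 ≤ T) :
    ∑ n ∈ Finset.Icc 2 T, (n : ℝ) ^ (-x) ≤ zetaSum x - 1 := by
  have hpartial : ∑ t ∈ Finset.range T, ((t : ℝ) + 1) ^ (-x)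
      = 1 + ∑ n ∈ Finset.Icc 2 T, (n : ℝ) ^ (-x) := by
    induction T, hT using Nat.le_induction with
    | base => simp
    | succ t ht ih =>
      rw [Finset.sum_range_succ, ih, Finset.sum_Icc_succ_top (by omega)]
      push_cast
      ring
  have htsum : ∑ t ∈ Finset.range T, ((t : ℝ) + 1) ^ (-x) ≤ zetaSum x :=
    (summable_add_one_rpow_neg hx).sum_le_tsum _ fun t _ => by positivity
  linarith

lemma IsExplorationSequence.sum_Icc_le_zetaSum {M : ℕ} {w x C : ℝ} {R : Set ℕ} {p : ℕ → ℝ}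
    (hR : IsExplorationSequence M w R) (hw : 0 ≤ w) (hx : 1 < x) (hC : 0 ≤ C)
    (hp_one : ∀ n, p n ≤ 1) (hp : ∀ n, 2 ≤ n → n ∉ R → p n ≤ C * (n : ℝ) ^ (-x)) {T : ℕ}
    (hT : 1 ≤ T) :
    ∑ n ∈ Finset.Icc 1 T, p n ≤ 1 + (M * (⌈w * Real.log T⌉ : ℝ) + C * (zetaSum x - 1)) := by
  classical
  have hslot : ∀ n ∈ Finset.Icc 2 T, p n ≤ (if n ∈ R then 1 else 0) + C * (n : ℝ) ^ (-x) :=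
    fun n hn => by
      have hpow : 0 ≤ C * (n : ℝ) ^ (-x) := by positivity
      split_ifs with hnR
      · linarith [hp_one n]
      · linarith [hp n (Finset.mem_Icc.1 hn).1 hnR]
  have hcard : (((Finset.Icc 2 T).filter (· ∈ R)).card : ℝ) ≤ M * (⌈w * Real.log T⌉ : ℝ) := by
    exact_mod_cast hR.card_filter_Icc_le hw hT
  have htail : ∑ n ∈ Finset.Icc 2 T, p n ≤ M * (⌈w * Real.log T⌉ : ℝ) + C * (zetaSum x - 1) := by
    refine (Finset.sum_le_sum hslot).trans ?_
    rw [Finset.sum_add_distrib, ← Finset.mul_sum, Finset.sum_boole]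
    exact add_le_add hcard (mul_le_mul_of_nonneg_left (sum_Icc_two_rpow_neg_le hx hT) hC)
  rw [← Finset.insert_Icc_add_one_left_eq_Icc hT, Finset.sum_insert (by simp)]
  exact add_le_add (hp_one 1) htail

variable {S A : Type*} [Fintype S] [Finite A] {M : ℕ} [NeZero M] {𝓜 : MDP S A} {m : Fin M → A → ℝ}
  {h : S → ℝ} {D : ℝ}

lemma bestRate_le_muMax (m : Fin M → A → ℝ) (a : A) : bestRate m a ≤ muMax m :=
  le_ciSup (Set.finite_range _).bddAbove a

namespace MDP

lemma optRate_sub_le_deltaMax (𝓜 : MDP S A) (m : Fin M → A → ℝ) (j : Fin M) (a : A) :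
    𝓜.optRate m - m j a ≤ 𝓜.deltaMax m :=
  sub_le_sub_left
    (ciInf_le (f := fun p : A × Fin M => m p.2 p.1) (Set.finite_range _).bddBelow (a, j)) _

lemma deltaMax_nonneg [Nonempty S] (𝓜 : MDP S A) (m : Fin M → A → ℝ) : 0 ≤ 𝓜.deltaMax m := by
  obtain ⟨hπ, hsum, -⟩ := isStationary_stationaryDist (𝓜.bestPolicy m)
  have havg : ∑ s, 𝓜.stationaryDist (𝓜.bestPolicy m) s * (𝓜.optRate m - 𝓜.deltaMax m)
      ≤ 𝓜.optRate m := Finset.sum_le_sum fun s _ =>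
    mul_le_mul_of_nonneg_left (sub_le_comm.1 (optRate_sub_le_deltaMax 𝓜 m _ _)) (hπ s)
  rw [← Finset.sum_mul, hsum] at havg
  linarith

/-- `h` is a bias function of the optimal policy `β*`, whose reward in state `s` is `μ*(β*(s))`. -/
def IsBias (𝓜 : MDP S A) (m : Fin M → A → ℝ) (h : S → ℝ) : Prop :=
  SolvesPoisson (𝓜.chain (𝓜.bestPolicy m)) (fun s => bestRate m (𝓜.bestPolicy m s)) (𝓜.optRate m) h

lemma exists_isBias [Nonempty S] (hm : ∀ j a, 0 ≤ m j a) (hγ : 𝓜.gamma m < 1) :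
    ∃ h, 𝓜.IsBias m h ∧ ∀ s s', h s - h s' ≤ muMax m / (1 - 𝓜.gamma m) := by
  obtain ⟨h, hh⟩ := (isStationary_stationaryDist (𝓜.bestPolicy m)).exists_solvesPoisson
    (chain_sum _) hγ fun s => bestRate m (𝓜.bestPolicy m s)
  refine ⟨h, hh, hh.sub_le (chain_sum _) hγ fun s s' => ?_⟩
  exact (sub_le_self _ (hm _ _)).trans (bestRate_le_muMax m _)

lemma IsBias.optRate_add_sub_eq_zero (hh : 𝓜.IsBias m h) {s : S} {a : A} {j : Fin M}
    (ha : a = 𝓜.bestPolicy m s) (hj : m j a = bestRate m a) :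
    𝓜.optRate m + h s - 𝓜.trans s a ⬝ᵥ h - m j a = 0 := by
  have hs : bestRate m (𝓜.bestPolicy m s) + 𝓜.trans s (𝓜.bestPolicy m s) ⬝ᵥ h
      = 𝓜.optRate m + h s := hh s
  rw [hj, ha]
  linarith

lemma optRate_add_sub_le (hD : ∀ s s', h s - h s' ≤ D) {s : S} {a : A} (ha : a ∈ 𝓜.act s)
    (j : Fin M) : 𝓜.optRate m + h s - 𝓜.trans s a ⬝ᵥ h - m j a ≤ 𝓜.deltaMax m + D := by
  have hbias : ∑ s', 𝓜.trans s a s' * (h s - D) ≤ 𝓜.trans s a ⬝ᵥ h :=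
    Finset.sum_le_sum fun s' _ =>
      mul_le_mul_of_nonneg_left (sub_le_comm.1 (hD s s')) (𝓜.trans_nonneg s a ha s')
  rw [← Finset.sum_mul, 𝓜.trans_sum s a ha] at hbias
  linarith [optRate_sub_le_deltaMax 𝓜 m j a]

/-- The event that the action or the channel used in slot `n` is not optimal: the action is not
`β*(s_n)`, or the channel does not have the largest mean rate for this action. -/
def suboptimalEvent {Ω : Type*} (𝓜 : MDP S A) (m : Fin M → A → ℝ) (st : ℕ → Ω → S)
    (ac : ℕ → Ω → A) (ch : ℕ → Ω → Fin M) (n : ℕ) : Set Ω :=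
  {ω | ¬(ac n ω = 𝓜.bestPolicy m (st n ω) ∧ m (ch n ω) (ac n ω) = bestRate m (ac n ω))}

end MDP

variable {𝒳 Ω : Type*} [MeasurableSpace 𝒳] {mΩ : MeasurableSpace Ω} {Pr : Measure Ω}
  {f : A → 𝒳 → ℝ} {ν : Fin M → Measure 𝒳} {ℱ : Filtration ℕ mΩ} {X : ℕ → Ω → Fin M → 𝒳}
  {st : ℕ → Ω → S} {ac : ℕ → Ω → A} {ch : ℕ → Ω → Fin M}

namespace IsControlledSystem

lemma measurableSet_suboptimalEvent (hsys : IsControlledSystem 𝓜 ν Pr ℱ X st ac ch)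
    (m : Fin M → A → ℝ) {n : ℕ} (hn : 1 ≤ n) :
    MeasurableSet (𝓜.suboptimalEvent m st ac ch n) := by
  have hunion : 𝓜.suboptimalEvent m st ac ch n =
      ⋃ p ∈ {p : S × A × Fin M | ¬(p.2.1 = 𝓜.bestPolicy m p.1 ∧ m p.2.2 p.2.1 = bestRate m p.2.1)},
        {ω | (st n ω, ac n ω, ch n ω) = p} := by
    ext ω
    simp [MDP.suboptimalEvent]
  rw [hunion]
  exact MeasurableSet.biUnion (Set.to_countable _) fun p _ =>
    ℱ.le n _ (hsys.measurableSet_decision_eq hn p)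

variable [IsProbabilityMeasure Pr]

lemma optRate_sub_integral_reward_le (hsys : IsControlledSystem 𝓜 ν Pr ℱ X st ac ch)
    (hf_meas : ∀ a, Measurable (f a)) (hf : ∀ j a, Integrable (f a) (ν j))
    (hh : 𝓜.IsBias (meanRate f ν) h) (hD : ∀ s s', h s - h s' ≤ D) {n : ℕ} (hn : 1 ≤ n) :
    𝓜.optRate (meanRate f ν) - ∫ ω, f (ac n ω) (X n ω (ch n ω)) ∂Pr ≤
      ∫ ω, h (st (n + 1) ω) ∂Pr - ∫ ω, h (st n ω) ∂Pr + (𝓜.deltaMax (meanRate f ν) + D)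
        * Pr.real (𝓜.suboptimalEvent (meanRate f ν) st ac ch n) := by
  set m := meanRate f ν
  set B := 𝓜.suboptimalEvent m st ac ch n
  have hB : MeasurableSet B := hsys.measurableSet_suboptimalEvent m hn
  have hle : ∀ ω, 𝓜.optRate m + h (st n ω) - 𝓜.trans (st n ω) (ac n ω) ⬝ᵥ h
      - m (ch n ω) (ac n ω) ≤ B.indicator (fun _ => 𝓜.deltaMax m + D) ω := fun ω => by
    by_cases hω : ω ∈ B
    · rw [Set.indicator_of_mem hω]
      exact MDP.optRate_add_sub_le hD (hsys.action_valid n hn ω) _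
    · rw [Set.indicator_of_notMem hω]
      obtain ⟨hac, hch⟩ := not_not.1 hω
      exact (hh.optRate_add_sub_eq_zero hac hch).le
  have hstate : Integrable (fun ω => 𝓜.optRate m + h (st n ω)) Pr :=
    hsys.integrable_decision hn fun s _ _ => 𝓜.optRate m + h s
  have hnext : Integrable (fun ω => 𝓜.trans (st n ω) (ac n ω) ⬝ᵥ h) Pr :=
    hsys.integrable_decision hn fun s a _ => 𝓜.trans s a ⬝ᵥ h
  have hrate : Integrable (fun ω => m (ch n ω) (ac n ω)) Pr :=
    hsys.integrable_decision hn fun _ a j => m j a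
  have hmono := integral_mono ((hstate.sub hnext).sub hrate)
    ((integrable_const (𝓜.deltaMax m + D)).indicator hB) hle
  rw [integral_sub' (hstate.sub hnext) hrate, integral_sub' hstate hnext,
    integral_add (integrable_const _) (hsys.integrable_decision hn fun s _ _ => h s),
    integral_const, probReal_univ, one_smul, integral_indicator_const _ hB, smul_eq_mul, mul_comm,
    ← hsys.integral_next_state hn h, ← hsys.integral_reward hf_meas hf hn] at hmono
  linarith

theorem regret_le (hsys : IsControlledSystem 𝓜 ν Pr ℱ X st ac ch)
    (hf_meas : ∀ a, Measurable (f a)) (hf : ∀ j a, Integrable (f a) (ν j))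
    (hh : 𝓜.IsBias (meanRate f ν) h) (hD : ∀ s s', h s - h s' ≤ D) (T : ℕ) :
    regret Pr f (𝓜.optRate (meanRate f ν)) X ac ch T ≤ D + (𝓜.deltaMax (meanRate f ν) + D)
      * ∑ n ∈ Finset.Icc 1 T, Pr.real (𝓜.suboptimalEvent (meanRate f ν) st ac ch n) := by
  set m := meanRate f ν
  have hbias : ∀ n, 1 ≤ n → Integrable (fun ω => h (st n ω)) Pr := fun n hn =>
    hsys.integrable_decision hn fun s _ _ => h s
  have hboundary : ∫ ω, h (st (T + 1) ω) ∂Pr - ∫ ω, h (st 1 ω) ∂Pr ≤ D := by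
    rw [← integral_sub (hbias _ (by omega)) (hbias _ le_rfl)]
    refine (integral_mono ((hbias _ (by omega)).sub (hbias _ le_rfl)) (integrable_const D)
      fun ω => hD _ _).trans_eq ?_
    simp
  calc regret Pr f (𝓜.optRate m) X ac ch T
      = ∑ n ∈ Finset.Icc 1 T, (𝓜.optRate m - ∫ ω, f (ac n ω) (X n ω (ch n ω)) ∂Pr) := by
        rw [regret, integral_finsetSum _ fun n hn =>
          hsys.integrable_reward hf (Finset.mem_Icc.1 hn).1]
        simp
    _ ≤ ∑ n ∈ Finset.Icc 1 T, (∫ ω, h (st (n + 1) ω) ∂Pr - ∫ ω, h (st n ω) ∂Pr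
          + (𝓜.deltaMax m + D) * Pr.real (𝓜.suboptimalEvent m st ac ch n)) :=
        Finset.sum_le_sum fun n hn =>
          hsys.optRate_sub_integral_reward_le hf_meas hf hh hD (Finset.mem_Icc.1 hn).1
    _ = ∫ ω, h (st (T + 1) ω) ∂Pr - ∫ ω, h (st 1 ω) ∂Pr + (𝓜.deltaMax m + D)
          * ∑ n ∈ Finset.Icc 1 T, Pr.real (𝓜.suboptimalEvent m st ac ch n) := by
        rw [Finset.sum_add_distrib, ← Finset.mul_sum, ← Finset.Ico_add_one_right_eq_Icc,
          Finset.sum_Ico_sub (fun n => ∫ ω, h (st n ω) ∂Pr) (by omega)]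
    _ ≤ _ := add_le_add_left hboundary _

end IsControlledSystem

end Regret

theorem IsMCLPSM.measureReal_suboptimalEvent_le {S A 𝒳 Ω : Type*} [Fintype S] [Fintype A]
    [MeasurableSpace 𝒳] {mΩ : MeasurableSpace Ω} {Pr : Measure Ω} [IsProbabilityMeasure Pr] {M : ℕ}
    [NeZero M] {𝓜 : MDP S A} {f : A → 𝒳 → ℝ} {ν : Fin M → Measure 𝒳} {R : Set ℕ}
    {ℱ : Filtration ℕ mΩ} {X : ℕ → Ω → Fin M → 𝒳} {st : ℕ → Ω → S} {ac : ℕ → Ω → A}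
    {ch : ℕ → Ω → Fin M} {β : ℕ → Ω → 𝓜.Policy} {φ : ℕ → Ω → A → Fin M} {d w : ℝ}
    (halg : IsMCLPSM 𝓜 f R ℱ X st ac ch β φ) (hsys : IsControlledSystem 𝓜 ν Pr ℱ X st ac ch)
    (hirr : (𝓜.chain (𝓜.bestPolicy (meanRate f ν))).IsIrreducible)
    (hγ : 𝓜.gamma (meanRate f ν) < 1) (hf : ∀ a, Measurable (f a))
    (hbelow : ∀ a, BddBelow (Set.range (f a))) (habove : ∀ a, BddAbove (Set.range (f a)))
    (hw : 0 < w) (hR : IsExplorationSequence M w R) (hd : 0 ≤ d)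
    (hdΔ : (d : EReal) ≤ min (delta3 (meanRate f ν)) (𝓜.delta4 (meanRate f ν)))
    {n : ℕ} (hn : 2 ≤ n) (hnR : n ∉ R) :
    Pr.real (𝓜.suboptimalEvent (meanRate f ν) st ac ch n) ≤
      2 * Fintype.card A * M * (n : ℝ) ^ (-(w * d ^ 2 / (2 * rateRange f ^ 2))) := by
  refine (measureReal_mono fun ω hω => ?_).trans
    (hsys.measureReal_exists_abs_estimate_sub_ge_le hf hbelow habove hw hR hn hnR hd)
  by_contra! hθ
  exact hω (halg.optimal_decision_of_abs_sub_lt hirr hγ hw hR hdΔ hn hnR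
    (by simpa only [Set.mem_ofPred_eq, not_exists, not_le] using hθ))

end MCLPSM

theorem mainTheorem4_general
    {S A 𝒳 Ω : Type*} [Fintype S] [Fintype A] [MeasurableSpace 𝒳]
    {mΩ : MeasurableSpace Ω} (Pr : Measure Ω) [IsProbabilityMeasure Pr]
    (M : ℕ) [NeZero M]
    (𝓜 : MDP S A) (f : A → 𝒳 → ℝ) (ν : Fin M → Measure 𝒳)
    (hirr : ∀ β : 𝓜.Policy, (𝓜.chain β).IsIrreducible)
    (hf_meas : ∀ a, Measurable (f a)) (hf_nonneg : ∀ a x, 0 ≤ f a x)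
    (hf_bdd : ∀ a, BddAbove (Set.range (f a)))
    (hB₀ : 0 < rateRange f) (hγ : 𝓜.gamma (meanRate f ν) < 1)
    (d w : ℝ) (hd : 0 < d)
    (hdΔ : (d : EReal) ≤ min (delta3 (meanRate f ν)) (𝓜.delta4 (meanRate f ν)))
    (hw : 2 * rateRange f ^ 2 / d ^ 2 < w)
    (R : Set ℕ) (hR : IsExplorationSequence M w R)
    (ℱ : Filtration ℕ mΩ) (X : ℕ → Ω → Fin M → 𝒳) (st : ℕ → Ω → S) (ac : ℕ → Ω → A)
    (ch : ℕ → Ω → Fin M) (β : ℕ → Ω → 𝓜.Policy) (φ : ℕ → Ω → A → Fin M)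
    (hsys : IsControlledSystem 𝓜 ν Pr ℱ X st ac ch)
    (halg : IsMCLPSM 𝓜 f R ℱ X st ac ch β φ) :
    Summable (fun t : ℕ => ((t : ℝ) + 1) ^ (-(w * d ^ 2 / (2 * rateRange f ^ 2)))) ∧
    ∀ T : ℕ, 1 ≤ T →
      regret Pr f (𝓜.optRate (meanRate f ν)) X ac ch T ≤
        (M * (⌈w * Real.log T⌉ : ℝ)
            + 2 * Fintype.card A * M * zetaSum (w * d ^ 2 / (2 * rateRange f ^ 2)))
          * (𝓜.deltaMax (meanRate f ν)
            + muMax (meanRate f ν) / (1 - 𝓜.gamma (meanRate f ν))) := by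
  set m := meanRate f ν
  set x := w * d ^ 2 / (2 * rateRange f ^ 2)
  have hw_pos : 0 < w := lt_of_le_of_lt (by positivity) hw
  have hx : 1 < x := (one_lt_div (by positivity)).2 ((div_lt_iff₀ (by positivity)).1 hw)
  refine ⟨summable_add_one_rpow_neg hx, fun T hT => ?_⟩
  obtain ⟨ω₀⟩ := nonempty_of_isProbabilityMeasure Pr
  have : Nonempty S := ⟨st 1 ω₀⟩
  have : Nonempty A := ⟨ac 1 ω₀⟩
  have hbelow : ∀ a, BddBelow (Set.range (f a)) := fun a =>
    ⟨0, Set.forall_mem_range.2 (hf_nonneg a)⟩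
  obtain ⟨h, hh, hD⟩ := MDP.exists_isBias (m := m) (fun j a => integral_nonneg (hf_nonneg a)) hγ
  have hregret := hsys.regret_le hf_meas
    (fun j a => hsys.integrable_gainLaw (hf_meas a) (hbelow a) (hf_bdd a) j) hh hD T
  have hprob := hR.sum_Icc_le_zetaSum hw_pos.le hx (C := 2 * Fintype.card A * M) (by positivity)
    (fun n => measureReal_le_one) (fun n => halg.measureReal_suboptimalEvent_le hsys (hirr _) hγ
      hf_meas hbelow hf_bdd hw_pos hR hd.le hdΔ) hT
  have hD_nonneg : 0 ≤ muMax m / (1 - 𝓜.gamma m) := by simpa using hD (st 1 ω₀) (st 1 ω₀)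
  have hΔ_nonneg := 𝓜.deltaMax_nonneg m
  have hC : (2 : ℝ) ≤ 2 * Fintype.card A * M := by
    exact_mod_cast (mul_assoc 2 _ M).symm ▸
      Nat.le_mul_of_pos_right 2 (Nat.mul_pos Fintype.card_pos (Nat.pos_of_neZero M))
  have hK := add_nonneg hΔ_nonneg hD_nonneg
  linarith [mul_le_mul_of_nonneg_left hprob hK, mul_le_mul_of_nonneg_right hC hK]

theorem mainTheorem4
    {S A 𝒳 Ω : Type*} [Fintype S] [DecidableEq S] [Fintype A] [MeasurableSpace 𝒳]
    {mΩ : MeasurableSpace Ω} (Pr : Measure Ω) [IsProbabilityMeasure Pr]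
    (M : ℕ) [NeZero M]
    -- the MDP, the rate function and the gain laws of the channels
    (𝓜 : MDP S A) (f : A → 𝒳 → ℝ) (ν : Fin M → Measure 𝒳)
    (hergodic : 𝓜.IsErgodic)
    (hf_meas : ∀ a, Measurable (f a)) (hf_nonneg : ∀ a x, 0 ≤ f a x)
    (hf_bdd : ∀ a, BddAbove (Set.range (f a)))
    (hB₀ : 0 < rateRange f) (hγ : 𝓜.gamma (meanRate f ν) < 1)
    -- the parameters of the algorithm
    (d w : ℝ) (hd : 0 < d)
    (hdΔ : (d : EReal) ≤ min (delta3 (meanRate f ν)) (𝓜.delta4 (meanRate f ν)))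
    (hw : 2 * rateRange f ^ 2 / d ^ 2 < w)
    (R : Set ℕ) (hR : IsExplorationSequence M w R)
    -- a run of MC-LPSM
    (ℱ : Filtration ℕ mΩ) (X : ℕ → Ω → Fin M → 𝒳) (st : ℕ → Ω → S) (ac : ℕ → Ω → A)
    (ch : ℕ → Ω → Fin M) (β : ℕ → Ω → 𝓜.Policy) (φ : ℕ → Ω → A → Fin M)
    (hsys : IsControlledSystem 𝓜 ν Pr ℱ X st ac ch)
    (halg : IsMCLPSM 𝓜 f R ℱ X st ac ch β φ) :
    Summable (fun t : ℕ => ((t : ℝ) + 1) ^ (-(w * d ^ 2 / (2 * rateRange f ^ 2)))) ∧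
    ∀ T : ℕ, 1 ≤ T →
      regret Pr f (𝓜.optRate (meanRate f ν)) X ac ch T ≤
        (M * (⌈w * Real.log T⌉ : ℝ)
            + 2 * Fintype.card A * M * zetaSum (w * d ^ 2 / (2 * rateRange f ^ 2)))
          * (𝓜.deltaMax (meanRate f ν)
            + muMax (meanRate f ν) / (1 - 𝓜.gamma (meanRate f ν))) :=
  mainTheorem4_general Pr M 𝓜 f ν (fun β => (hergodic β).1) hf_meas hf_nonneg hf_bdd hB₀ hγ d w hd
    hdΔ hw R hR ℱ X st ac ch β φ hsys halg
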